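/- Let $n\ge 3$ and let $D_n=SO(2n,\mathbb C)$ be the group of complex $2n\times 2n$ matrices of determinant one that preserve the nondegenerate quadratic form $\sum_{i=1}^n x_iy_i$ on $\mathbb C^{2n}$. Let $T=\{\mathrm{diag}(t_1,\dots,t_n,t_1^{-1},\dots,t_n^{-1})\}$ be its standard maximal torus, and let $l_i$ be the character of $T$ with value $t_i$, so that the roots are $\pm l_i\pm l_j$ ($i\neq j$). Take the positive system with simple roots $l_1+l_2$ and $l_i-l_{i-1}$ ($2\le i\le n$), for which $l_n$ is a fundamental weight. Let $V=V_{l_n}$ be a finite-dimensional irreducible algebraic representation of $D_n$ over $\mathbb C$ with highest weight $l_n$, let $w\in V$ be a highest weight vector, and let $P\subset D_n$ be the maximal parabolic subgroup associated with $l_n$, that is, the subgroup generated by $T$ and the root subgroups $U_\alpha$ of all roots $\alpha$ with $\langle l_n,\alpha^\vee\rangle\ge 0$. Then there exists a basis $\{u_i,v_i\mid i=1,\dots,n\}$ of $V$, with $u_i$ of weight $l_i$ and $v_i$ of weight $-l_i$, such that the following holds. The map $gP\mapsto [g\,w]$ is a well-defined injection $D_n/P\to\mathbb P(V)$ into the space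 of lines in $V$; and, in the homogeneous coordinates $(x_1,\dots,x_n,y_1,\dots,y_n)$ of $\sum_i (x_iu_i+y_iv_i)$, its image is the subvariety defined by the quadratic equation $$Q(x_1,y_1,\dots,x_n,y_n)=\sum_{i=1}^n x_iy_i=0,$$ both as a set and in the sense that the ideal of all polynomials in $\mathbb C[x_1,y_1,\dots,x_n,y_n]$ vanishing on the affine cone over $D_n/P$ is generated by $Q$. -/

import Mathlib

open Matrix MvPolynomial
open scoped LinearAlgebra.Projectivization

/-! The complex Lie group of type `D_n` in its split realization, its maximal torus, its root
subgroups, and the objects attached to a highest weight. -/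

namespace TypeD

/-- The index set `{1, …, n} ⊔ {1, …, n}` of the standard basis `e_1, …, e_n, e_1', …, e_n'` of
`ℂ^{2n}`; the bilinear form pairs `e_i` with `e_i'`. -/
abbrev Idx (n : ℕ) : Type := Fin n ⊕ Fin n

/-- `SO(2n, ℂ)`: the complex `2n × 2n` matrices of determinant one preserving the nondegenerate
symmetric bilinear form with Gram matrix `[[0, 1], [1, 0]]`, that is, preserving the quadratic form
`∑ x_i y_i`. -/
def SO (n : ℕ) : Subgroup (SpecialLinearGroup (Idx n) ℂ) where
  carrier := {A | A.1ᵀ * LieAlgebra.Orthogonal.JD (Fin n) ℂ * A.1 =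
    LieAlgebra.Orthogonal.JD (Fin n) ℂ}
  one_mem' := by
    change (1 : Matrix (Idx n) (Idx n) ℂ)ᵀ * _ * 1 = _
    simp
  mul_mem' := by
    intro A B hA hB
    change A.1ᵀ * _ * A.1 = _ at hA
    change B.1ᵀ * _ * B.1 = _ at hB
    change (A.1 * B.1)ᵀ * _ * (A.1 * B.1) = _
    calc _ = B.1ᵀ * (A.1ᵀ * LieAlgebra.Orthogonal.JD (Fin n) ℂ * A.1) * B.1 := by
          simp only [transpose_mul, Matrix.mul_assoc]
      _ = _ := by rw [hA, hB]
  inv_mem' := by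
    intro A hA
    change A.1ᵀ * _ * A.1 = _ at hA
    change (A⁻¹).1ᵀ * _ * (A⁻¹).1 = _
    have h1 : A.1 * (A⁻¹).1 = 1 := congrArg Subtype.val (mul_inv_cancel A)
    have h2 : (A⁻¹).1ᵀ * A.1ᵀ = 1 := by rw [← transpose_mul, h1, transpose_one]
    conv_lhs => rw [← hA]
    calc _ = ((A⁻¹).1ᵀ * A.1ᵀ) * LieAlgebra.Orthogonal.JD (Fin n) ℂ * (A.1 * (A⁻¹).1) := by
          simp only [Matrix.mul_assoc]
      _ = _ := by rw [h1, h2, Matrix.one_mul, Matrix.mul_one]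

theorem torus_det {n : ℕ} (t : Fin n → ℂˣ) :
    (diagonal (Sum.elim (fun i => (t i : ℂ)) (fun i => ((t i)⁻¹ : ℂˣ))) :
      Matrix (Idx n) (Idx n) ℂ).det = 1 := by
  rw [det_diagonal, Fintype.prod_sum_type]
  simp only [Sum.elim_inl, Sum.elim_inr, ← Finset.prod_mul_distrib, Units.mul_inv,
    Finset.prod_const_one]

/-- The element `diag(t_1, …, t_n, t_1⁻¹, …, t_n⁻¹)` of the standard maximal torus. -/
def torus {n : ℕ} (t : Fin n → ℂˣ) : SO n :=
  ⟨⟨diagonal (Sum.elim (fun i => (t i : ℂ)) (fun i => ((t i)⁻¹ : ℂˣ))), torus_det t⟩, by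
    change (diagonal _)ᵀ * LieAlgebra.Orthogonal.JD (Fin n) ℂ * diagonal _ = _
    ext a b
    rw [diagonal_transpose, mul_diagonal, diagonal_mul]
    rcases a with i | i <;> rcases b with j | j <;>
      simp only [LieAlgebra.Orthogonal.JD, fromBlocks_apply₁₁, fromBlocks_apply₁₂,
        fromBlocks_apply₂₁, fromBlocks_apply₂₂, Matrix.zero_apply, Matrix.one_apply,
        Sum.elim_inl, Sum.elim_inr, mul_zero, zero_mul] <;>
      by_cases h : i = j <;> simp [h]⟩

/-- Weights, written in the basis `l_1, …, l_n` of the character group of the torus, where `l_i`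
is the character `diag(t, t⁻¹) ↦ t_i`. -/
abbrev Weight (n : ℕ) : Type := Fin n → ℤ

/-- The weight of the standard basis vector with index `a`: it is `l_i` for `a = inl i` and `-l_i`
for `a = inr i`. -/
def wt {n : ℕ} : Idx n → Weight n :=
  Sum.elim (fun i => Pi.single i 1) (fun i => -Pi.single i 1)

theorem root_matrix_det {n : ℕ} (a b : Idx n) (hab : a ≠ b) (s : ℂ) :
    (1 + s • (single a b 1 - single b.swap a.swap 1) : Matrix (Idx n) (Idx n) ℂ).det = 1 := by
  have hb : b ≠ b.swap := by rcases b with i | i <;> simp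
  have hab' : b.swap ≠ a.swap := fun h => hab (Sum.swap_leftInverse.injective h).symm
  have : (1 + s • (single a b 1 - single b.swap a.swap 1) : Matrix (Idx n) (Idx n) ℂ) =
      transvection a b s * transvection b.swap a.swap (-s) := by
    simp only [transvection, Matrix.add_mul, Matrix.mul_add, Matrix.one_mul,
      single_mul_single_of_ne _ _ _ _ hb, smul_sub, smul_single, smul_eq_mul, mul_one, add_zero]
    rw [← single_neg]
    abel
  rw [this, det_mul, det_transvection_of_ne _ _ hab, det_transvection_of_ne _ _ hab', one_mul]

theorem root_matrix_form {n : ℕ} (a b : Idx n) (hab : a ≠ b) (s : ℂ) :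
    (1 + s • (single a b 1 - single b.swap a.swap 1) : Matrix (Idx n) (Idx n) ℂ)ᵀ *
      LieAlgebra.Orthogonal.JD (Fin n) ℂ *
      (1 + s • (single a b 1 - single b.swap a.swap 1) : Matrix (Idx n) (Idx n) ℂ) =
      LieAlgebra.Orthogonal.JD (Fin n) ℂ := by
  have hswap : ∀ c : Idx n, c ≠ c.swap := by rintro (i | i) <;> simp
  have hab' : a.swap ≠ b.swap := fun h => hab (Sum.swap_leftInverse.injective h)
  have hJl : ∀ c d : Idx n, single c d (1 : ℂ) * LieAlgebra.Orthogonal.JD (Fin n) ℂ =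
      single c d.swap 1 := by
    intro c d
    ext x y
    rw [mul_apply, Finset.sum_eq_single d]
    · rcases d with i | i <;> rcases y with j | j <;>
        simp [LieAlgebra.Orthogonal.JD, Matrix.single_apply, Matrix.one_apply]
      all_goals grind
    · intro z _ hz
      simp [hz.symm]
    · simp
  have hJr : ∀ c d : Idx n, LieAlgebra.Orthogonal.JD (Fin n) ℂ * single c d (1 : ℂ) =
      single c.swap d 1 := by
    intro c d
    ext x y
    rw [mul_apply, Finset.sum_eq_single c]
    · rcases c with i | i <;> rcases x with j | j <;>
        simp [LieAlgebra.Orthogonal.JD, Matrix.single_apply, Matrix.one_apply]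
      all_goals grind
    · intro z _ hz
      simp [hz.symm]
    · simp
  simp only [transpose_add, transpose_one, transpose_smul, transpose_sub, transpose_single,
    Matrix.add_mul, Matrix.mul_add, Matrix.one_mul, Matrix.mul_one, Matrix.smul_mul,
    Matrix.mul_smul, Matrix.sub_mul, Matrix.mul_sub, hJl, hJr, Sum.swap_swap,
    single_mul_single_of_ne _ _ _ _ hab', single_mul_single_of_ne _ _ _ _ hab.symm,
    single_mul_single_of_ne _ _ _ _ (hswap _),
    single_mul_single_of_ne _ _ _ _ (hswap _).symm]
  simp only [smul_sub, smul_zero, sub_zero, smul_add]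
  abel

/-- The element `1 + s (E_{a,b} - E_{b',a'})` of the root subgroup `U_α` of the root
`α = wt a - wt b`, where `'` exchanges `inl i` and `inr i`. The roots `±l_i ± l_j` (`i ≠ j`) are
obtained exactly from the pairs with `a ≠ b` and `a ≠ b'`. -/
def rootElement {n : ℕ} (a b : Idx n) (hab : a ≠ b) (s : ℂ) : SO n :=
  ⟨⟨1 + s • (single a b 1 - single b.swap a.swap 1), root_matrix_det a b hab s⟩,
    root_matrix_form a b hab s⟩

/-- The positive roots `l_i + l_j` and `l_i - l_j` with `j < i`. The simple roots of this positive
system are `l_1 + l_2` and `l_i - l_{i-1}` for `2 ≤ i ≤ n`. -/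
def IsPositiveRoot {n : ℕ} (α : Weight n) : Prop :=
  ∃ i j : Fin n, j < i ∧
    (α = Pi.single i 1 + Pi.single j 1 ∨ α = Pi.single i 1 - Pi.single j 1)

/-- The parabolic subgroup associated with a dominant weight `lam`: it is generated by the maximal
torus and by the root subgroups `U_α` of all roots `α` with `⟨lam, α^∨⟩ ≥ 0`. (All roots have
squared length two, so that `⟨lam, α^∨⟩` is the standard scalar product of `lam` and `α`.) For a
fundamental weight this is the maximal parabolic subgroup of the corresponding node. -/
def parabolic {n : ℕ} (lam : Weight n) : Subgroup (SO n) :=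
  Subgroup.closure
    (Set.range (torus (n := n)) ∪
      {g | ∃ (a b : Idx n) (hab : a ≠ b) (s : ℂ), a ≠ b.swap ∧ 0 ≤ lam ⬝ᵥ (wt a - wt b) ∧
        g = rootElement a b hab s})

/-- A representation of the algebraic group `SO(2n, ℂ)`: the matrix coefficients of `ρ` are
polynomial functions of the matrix entries. -/
def IsAlgebraicRep {n : ℕ} {V : Type*} [AddCommGroup V] [Module ℂ V]
    (ρ : Representation ℂ (SO n) V) : Prop :=
  ∀ (v : V) (φ : Module.Dual ℂ V), ∃ p : MvPolynomial (Idx n × Idx n) ℂ, ∀ g : SO n,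
    φ (ρ g v) = eval (fun ij => (g : SpecialLinearGroup (Idx n) ℂ) ij.1 ij.2) p

/-- `v` is a vector of weight `μ`: the torus acts on it through the character `μ`. -/
def HasWeight {n : ℕ} {V : Type*} [AddCommGroup V] [Module ℂ V]
    (ρ : Representation ℂ (SO n) V) (μ : Weight n) (v : V) : Prop :=
  ∀ t : Fin n → ℂˣ, ρ (torus t) v = ((∏ i, t i ^ μ i : ℂˣ) : ℂ) • v

/-- `w` is a highest weight vector of weight `lam`: a nonzero vector of weight `lam` that is fixed
by the root subgroups of all positive roots. -/
def IsHighestWeightVector {n : ℕ} {V : Type*} [AddCommGroup V] [Module ℂ V]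
    (ρ : Representation ℂ (SO n) V) (lam : Weight n) (w : V) : Prop :=
  w ≠ 0 ∧ HasWeight ρ lam w ∧
    ∀ (a b : Idx n) (hab : a ≠ b) (s : ℂ), IsPositiveRoot (wt a - wt b) →
      ρ (rootElement a b hab s) w = w

/-- The affine cone in `ℂ^ι` over a subset of `ℙ(V)`, in the linear coordinates on `V` given by a
basis. -/
def coneInCoordinates {ι V : Type*} [AddCommGroup V] [Module ℂ V] (b : Module.Basis ι ℂ V)
    (S : Set (ℙ ℂ V)) : Set (ι → ℂ) :=
  {x | ∃ p ∈ S, ∃ v ∈ p.submodule, x = b.repr v}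

/-- The subset `S` of `ℙ(V)` is the subvariety defined by the equation `q = 0` in the homogeneous
coordinates given by a basis: `S` is the zero set of `q`, and `q` generates the ideal of `S`. -/
def IsDefinedBy {ι V : Type*} [AddCommGroup V] [Module ℂ V] (b : Module.Basis ι ℂ V)
    (S : Set (ℙ ℂ V)) (q : MvPolynomial ι ℂ) : Prop :=
  S = {p | ∀ v ∈ p.submodule, eval (b.repr v) q = 0} ∧
    vanishingIdeal ℂ (coneInCoordinates b S) = Ideal.span {q}

end TypeD

/-! The geometric core concerns the standard representation on `ℂ^{2n}`. An isotropic vector whose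
coordinate at `e_c` is nonzero is, up to scale, a product of root elements applied to `e_c`
(`exists_std_single_eq`). With at least two hyperbolic planes available, every nonzero isotropic
vector can be moved into this position, so the group is transitive on nonzero isotropic vectors
(`exists_std_single_eq_of_isotropic`). The orbit of the line through `e_m`, where `m` is the last
position, is therefore the quadric. Peeling off one plane at a time shows that an element preserving
this line is a product of generators of the parabolic (`mem_parabolic_of_std_eq_smul`), which gives
injectivity.

To transfer this to `V`, an equivariant isomorphism taking `w` to `e_m` is built without using
complete reducibility or a classification by highest weights. Let `Γ ⊂ V × ℂ^{2n}` be the span of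
the orbit of `(w, e_m)`. The crux is that `(0, y) ∈ Γ` forces `y = 0`: contracting by a
one-parameter torus subgroup recovers the coordinate of `y` at `e_m` as a limit computed from the
`V`-component alone (`tendsto_contraction`). This uses that the parabolic acts on `w` and on `e_m`
by the same character (`parabolic_acts_on_lines`), itself a consequence of algebraicity and a
rank-one Bruhat identity. Together with irreducibility of `V`, it makes `Γ` the graph of an
isomorphism (`exists_equiv_std`).

The statement about ideals is then the Nullstellensatz for the prime ideal generated by the
irreducible form `Q`. -/

namespace TypeD

variable {n : ℕ}

/-! ### Index positions, the standard representation and its invariant form. -/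

/-- The position in `{1, …, n}` of an index of the standard basis. -/
def pos : Idx n → Fin n := Sum.elim id id

@[simp] theorem pos_inl (i : Fin n) : pos (Sum.inl i : Idx n) = i := rfl

@[simp] theorem pos_inr (i : Fin n) : pos (Sum.inr i : Idx n) = i := rfl

@[simp] theorem pos_swap (a : Idx n) : pos a.swap = pos a := by
  rcases a with i | i <;> rfl

theorem eq_or_eq_swap_of_pos_eq {a b : Idx n} (h : pos a = pos b) : a = b ∨ a = b.swap := by
  rcases a with i | i <;> rcases b with j | j <;> simp_all

theorem ne_of_pos_ne {a b : Idx n} (h : pos a ≠ pos b) : a ≠ b := fun h' => h (by rw [h'])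

theorem ne_swap_of_pos_ne {a b : Idx n} (h : pos a ≠ pos b) : a ≠ b.swap :=
  fun h' => h (by rw [h', pos_swap])

theorem pos_ne_of_ne {a b : Idx n} (h : a ≠ b) (h' : a ≠ b.swap) : pos a ≠ pos b := fun hp =>
  (eq_or_eq_swap_of_pos_eq hp).elim h h'

theorem ne_swap_self (a : Idx n) : a ≠ a.swap := by rcases a with i | i <;> simp

/-- The standard representation of `SO(2n, ℂ)`. -/
def std (n : ℕ) : Representation ℂ (SO n) (Idx n → ℂ) where
  toFun g := Matrix.mulVecLin g.1.1
  map_one' := Matrix.mulVecLin_one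
  map_mul' g h := Matrix.mulVecLin_mul g.1.1 h.1.1

theorem std_apply (g : SO n) (v : Idx n → ℂ) : std n g v = g.1.1 *ᵥ v := rfl

theorem std_single (g : SO n) (a c : Idx n) : std n g (Pi.single c 1) a = g.1.1 a c := by
  rw [std_apply, mulVec_single_one, col_apply]

theorem std_rootElement (a b : Idx n) (hab : a ≠ b) (s : ℂ) (v : Idx n → ℂ) :
    std n (rootElement a b hab s) v =
      v + s • (Pi.single a (v b) - Pi.single b.swap (v a.swap)) := by
  change (1 + s • (single a b 1 - single b.swap a.swap 1) : Matrix (Idx n) (Idx n) ℂ) *ᵥ v = _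
  rw [add_mulVec, one_mulVec, smul_mulVec, sub_mulVec, single_mulVec, single_mulVec]
  simp [Pi.single]

/-- The eigenvalue of `diag(t, t⁻¹)` on the basis vector with index `c`. -/
def torusEntry (t : Fin n → ℂˣ) : Idx n → ℂˣ := Sum.elim t (fun i => (t i)⁻¹)

theorem std_torus (t : Fin n → ℂˣ) (v : Idx n → ℂ) (c : Idx n) :
    std n (torus t) v c = torusEntry t c * v c := by
  change (diagonal _ *ᵥ v) c = _
  rw [mulVec_diagonal]
  rcases c with i | i <;> rfl

theorem std_torus_single (t : Fin n → ℂˣ) (c : Idx n) :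
    std n (torus t) (Pi.single c 1) = (torusEntry t c : ℂ) • Pi.single c 1 := by
  ext d
  rw [std_torus]
  by_cases h : d = c
  · subst h; simp
  · simp [h]

theorem std_injective {g h : SO n} (H : ∀ v, std n g v = std n h v) : g = h := by
  apply Subtype.ext
  apply Subtype.ext
  ext a c
  rw [← std_single, ← std_single, H]

/-- The symmetric bilinear form preserved by `SO(2n, ℂ)`. -/
def bil (v u : Idx n → ℂ) : ℂ := ∑ a, v a * u a.swap

theorem bil_single_right (v : Idx n → ℂ) (c : Idx n) (x : ℂ) :
    bil v (Pi.single c x) = v c.swap * x := by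
  rw [bil, Finset.sum_eq_single c.swap]
  · simp
  · intro b _ hb
    rw [Pi.single_eq_of_ne, mul_zero]
    rintro rfl
    simp at hb
  · simp

theorem bil_eq (v u : Idx n → ℂ) :
    bil v u = v ⬝ᵥ (LieAlgebra.Orthogonal.JD (Fin n) ℂ *ᵥ u) := by
  have : LieAlgebra.Orthogonal.JD (Fin n) ℂ *ᵥ u = fun a => u a.swap := by
    ext a
    rcases a with i | i <;> simp [LieAlgebra.Orthogonal.JD, fromBlocks_mulVec]
  rw [this]
  rfl

theorem bil_self (v : Idx n → ℂ) : bil v v = 2 * ∑ i, v (Sum.inl i) * v (Sum.inr i) := by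
  simp only [bil, Fintype.sum_sum_type, Sum.swap_inl, Sum.swap_inr, two_mul]
  congr 1
  exact Finset.sum_congr rfl fun i _ => mul_comm _ _

theorem bil_smul_left (x : ℂ) (v u : Idx n → ℂ) : bil (x • v) u = x * bil v u := by
  simp only [bil, Finset.mul_sum, Pi.smul_apply, smul_eq_mul, mul_assoc]

theorem bil_smul_right (x : ℂ) (v u : Idx n → ℂ) : bil v (x • u) = x * bil v u := by
  simp only [bil, Finset.mul_sum, Pi.smul_apply, smul_eq_mul, mul_left_comm]

theorem bil_std (g : SO n) (v u : Idx n → ℂ) : bil (std n g v) (std n g u) = bil v u := by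
  have hg : g.1.1ᵀ * LieAlgebra.Orthogonal.JD (Fin n) ℂ * g.1.1 =
    LieAlgebra.Orthogonal.JD (Fin n) ℂ := g.2
  rw [bil_eq, bil_eq, std_apply, std_apply]
  conv_rhs => rw [← hg, ← mulVec_mulVec, ← mulVec_mulVec, dotProduct_mulVec, vecMul_transpose]

theorem bil_single_self (c : Idx n) : bil (Pi.single c 1) (Pi.single c (1 : ℂ)) = 0 := by
  rw [bil_single_right, Pi.single_eq_of_ne (ne_swap_self c).symm, zero_mul]

/-! ### Stabilizers and transitivity on isotropic vectors. -/

/-- The stabilizer of a vector of the standard representation. -/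
def fixer (v : Idx n → ℂ) : Subgroup (SO n) where
  carrier := {g | std n g v = v}
  one_mem' := by simp
  mul_mem' := by
    intro g h hg hh
    change std n g v = v at hg
    change std n h v = v at hh
    change std n (g * h) v = v
    rw [map_mul, Module.End.mul_apply, hh, hg]
  inv_mem' := by
    intro g hg
    change std n g v = v at hg
    change std n g⁻¹ v = v
    conv_lhs => rw [← hg]
    rw [Representation.inv_self_apply]

theorem mem_fixer {v : Idx n → ℂ} {g : SO n} : g ∈ fixer v ↔ std n g v = v := Iff.rfl

theorem rootElement_mem_fixer {a b : Idx n} (hab : a ≠ b) (s : ℂ) {v : Idx n → ℂ} (hb : v b = 0)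
    (ha : v a.swap = 0) : rootElement a b hab s ∈ fixer v := by
  rw [mem_fixer, std_rootElement, ha, hb]
  simp

/-- An isotropic vector with coordinate `1` at `c` is obtained from the basis vector `e_c` by the
root elements that move `e_c`. -/
theorem exists_std_single_eq (M : Submonoid (SO n)) (c : Idx n) (v : Idx n → ℂ)
    (hv : bil v v = 0) (hc : v c = 1)
    (hM : ∀ (a : Idx n) (hac : a ≠ c) (s : ℂ), pos a ≠ pos c → v a ≠ 0 →
      rootElement a c hac s ∈ M) :
    ∃ h ∈ M, std n h (Pi.single c 1) = v := by
  classical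
  induction hN : (Finset.univ.filter fun a => pos a ≠ pos c ∧ v a ≠ 0).card using
    Nat.strong_induction_on generalizing v with
  | _ N ih =>
  by_cases hex : ∃ a, pos a ≠ pos c ∧ v a ≠ 0
  · obtain ⟨a, hac, hva⟩ := hex
    have hne := ne_of_pos_ne hac
    -- This root element clears the coordinate at `a`; the only other coordinate it changes is the
    -- one at `c.swap`, which is not counted by the induction.
    set v' := std n (rootElement a c hne (-v a)) v with hv'
    have hcoord : ∀ d, pos d ≠ pos c → v' d = if d = a then 0 else v d := by
      intro d hd
      rw [hv', std_rootElement, hc]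
      have := ne_swap_of_pos_ne hd
      by_cases hda : d = a
      · subst hda; simp [this]
      · simp [this, hda]
    have hcc : v' c = 1 := by
      rw [hv', std_rootElement, hc]
      simp [hne.symm, ne_swap_self c, hc]
    obtain ⟨h, hh, e⟩ := ih _ (by
      rw [← hN]
      apply Finset.card_lt_card
      rw [Finset.ssubset_iff_of_subset]
      · exact ⟨a, by simp [hac, hva], by simp [hcoord a hac]⟩
      · intro d
        simp only [Finset.mem_filter, Finset.mem_univ, true_and]
        rintro ⟨h1, h2⟩
        rw [hcoord d h1] at h2
        exact ⟨h1, by aesop⟩) v' (by rw [hv', bil_std, hv]) hcc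
      (fun d hdc s hd hvd => hM d hdc s hd (by rw [hcoord d hd] at hvd; aesop)) rfl
    refine ⟨rootElement a c hne (v a) * h, M.mul_mem (hM a hne _ hac hva) hh, ?_⟩
    rw [map_mul, Module.End.mul_apply, e, hv', std_rootElement, std_rootElement]
    ext d
    have h1 : c ≠ c.swap := ne_swap_self c
    have h2 : a.swap ≠ a := (ne_swap_self a).symm
    have h3 : a.swap ≠ c.swap := fun h => hne (Sum.swap_leftInverse.injective h)
    simp [hne.symm, h1, h2, h3, hc]
  · push Not at hex
    refine ⟨1, M.one_mem, ?_⟩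
    rw [map_one, Module.End.one_apply]
    -- Only the plane of `c` is left, where isotropy reads `2 * v c * v c.swap = 0`.
    have hsw : v c.swap = 0 := by
      rw [bil, Fintype.sum_eq_add c c.swap (ne_swap_self c)] at hv
      · rw [hc, Sum.swap_swap, hc] at hv
        linear_combination hv / 2
      · rintro x ⟨h1, h2⟩
        rw [hex x (pos_ne_of_ne h1 h2), zero_mul]
    ext d
    by_cases hd : pos d = pos c
    · rcases eq_or_eq_swap_of_pos_eq hd with rfl | rfl
      · simp [hc]
      · rw [hsw, Pi.single_eq_of_ne (ne_swap_self c).symm]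
    · rw [hex d hd, Pi.single_eq_of_ne (ne_of_pos_ne hd)]

/-- The one-parameter subgroup of the torus that scales the basis vector `e_c` by `z`. -/
def cochar (c : Idx n) (z : ℂˣ) : Fin n → ℂˣ :=
  Pi.mulSingle (pos c) (Sum.elim (fun _ => z) (fun _ => z⁻¹) c)

theorem torusEntry_swap (t : Fin n → ℂˣ) (c : Idx n) :
    torusEntry t c.swap = (torusEntry t c)⁻¹ := by
  rcases c with i | i <;> simp [torusEntry]

theorem torusEntry_mul (t u : Fin n → ℂˣ) (c : Idx n) :
    torusEntry (t * u) c = torusEntry t c * torusEntry u c := by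
  rcases c with i | i <;> simp [torusEntry, mul_comm]

theorem torusEntry_cochar_self (c : Idx n) (z : ℂˣ) : torusEntry (cochar c z) c = z := by
  rcases c with i | i <;> simp [torusEntry, cochar]

theorem torusEntry_cochar_of_ne {c d : Idx n} (h : pos d ≠ pos c) (z : ℂˣ) :
    torusEntry (cochar c z) d = 1 := by
  rcases d with i | i <;> simpa [torusEntry, cochar] using Pi.mulSingle_eq_of_ne h _

theorem cochar_of_ne {c : Idx n} {i : Fin n} (h : i ≠ pos c) (z : ℂˣ) : cochar c z i = 1 :=
  Pi.mulSingle_eq_of_ne h _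

theorem torus_mem_fixer_single {t : Fin n → ℂˣ} {c : Idx n} (h : t (pos c) = 1) :
    torus t ∈ fixer (Pi.single c 1) := by
  rw [mem_fixer, std_torus_single]
  rcases c with i | i <;> simp_all [torusEntry]

theorem rootElement_mem_fixer_single {a b c : Idx n} (hab : a ≠ b) (s : ℂ) (hb : b ≠ c)
    (ha : a.swap ≠ c) : rootElement a b hab s ∈ fixer (Pi.single c 1) :=
  rootElement_mem_fixer hab s (Pi.single_eq_of_ne hb _) (Pi.single_eq_of_ne ha _)

/-- The subgroup generated by the part of the torus and the root subgroups supported on a set of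
positions. -/
def generatedOn (K : Set (Fin n)) : Subgroup (SO n) :=
  Subgroup.closure
    ({g | ∃ t : Fin n → ℂˣ, (∀ i ∉ K, t i = 1) ∧ g = torus t} ∪
      {g | ∃ (a b : Idx n) (hab : a ≠ b) (s : ℂ), pos a ≠ pos b ∧ pos a ∈ K ∧ pos b ∈ K ∧
        g = rootElement a b hab s})

theorem torus_mem_generatedOn {K : Set (Fin n)} {t : Fin n → ℂˣ} (h : ∀ i ∉ K, t i = 1) :
    torus t ∈ generatedOn K := Subgroup.subset_closure (Or.inl ⟨t, h, rfl⟩)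

theorem cochar_mem_generatedOn {K : Set (Fin n)} {c : Idx n} (h : pos c ∈ K) (z : ℂˣ) :
    torus (cochar c z) ∈ generatedOn K :=
  torus_mem_generatedOn fun _ hi => cochar_of_ne (by rintro rfl; exact hi h) z

theorem rootElement_mem_generatedOn {K : Set (Fin n)} {a b : Idx n} (hab : a ≠ b) (s : ℂ)
    (h : pos a ≠ pos b) (ha : pos a ∈ K) (hb : pos b ∈ K) :
    rootElement a b hab s ∈ generatedOn K :=
  Subgroup.subset_closure (Or.inr ⟨a, b, hab, s, h, ha, hb, rfl⟩)

theorem generatedOn_le {K : Set (Fin n)} {H : Subgroup (SO n)}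
    (ht : ∀ t : Fin n → ℂˣ, (∀ i ∉ K, t i = 1) → torus t ∈ H)
    (hr : ∀ (a b : Idx n) (hab : a ≠ b) (s : ℂ), pos a ≠ pos b → pos a ∈ K → pos b ∈ K →
      rootElement a b hab s ∈ H) : generatedOn K ≤ H := by
  refine (Subgroup.closure_le _).2 ?_
  rintro g (⟨t, h, rfl⟩ | ⟨a, b, hab, s, h, ha, hb, rfl⟩)
  · exact ht t h
  · exact hr a b hab s h ha hb

theorem generatedOn_mono {K L : Set (Fin n)} (h : K ⊆ L) : generatedOn K ≤ generatedOn L :=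
  generatedOn_le (fun _ ht => torus_mem_generatedOn fun i hi => ht i fun h' => hi (h h'))
    fun _ _ hab s hp ha hb => rootElement_mem_generatedOn hab s hp (h ha) (h hb)

theorem generatedOn_le_fixer {K : Set (Fin n)} {c : Idx n} (hc : pos c ∉ K) :
    generatedOn K ≤ fixer (Pi.single c 1) := by
  refine generatedOn_le (fun t ht => torus_mem_fixer_single (ht _ hc)) ?_
  intro a b hab s _ ha hb
  refine rootElement_mem_fixer_single hab s ?_ ?_
  · rintro rfl; exact hc hb
  · rintro rfl; exact hc (by rwa [pos_swap])

theorem std_eq_of_inv {g : SO n} {v u : Idx n → ℂ} (h : std n g v = u) : std n g⁻¹ u = v := by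
  rw [← h, Representation.inv_self_apply]

/-- Rescaling reduces to coordinate `1` at `m`; the torus element `cochar m (v m)` restores the
scale. -/
theorem exists_std_single_eq_of_coord_ne_zero {K : Set (Fin n)} {m : Idx n} (hm : pos m ∈ K)
    {v : Idx n → ℂ} (hv : bil v v = 0) (hvm : v m ≠ 0) (hK : ∀ c, pos c ∉ K → v c = 0) :
    ∃ h ∈ generatedOn K, std n h (Pi.single m 1) = v := by
  obtain ⟨h, hh, e⟩ := exists_std_single_eq (generatedOn K).toSubmonoid m ((v m)⁻¹ • v)
    (by rw [bil_smul_left, bil_smul_right, hv, mul_zero, mul_zero]) (by simp [hvm])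
    (fun a hac s hp ha => rootElement_mem_generatedOn hac s hp
      (by_contra fun hna => ha (by simp [hK a hna])) hm)
  refine ⟨h * torus (cochar m (Units.mk0 _ hvm)), mul_mem hh (cochar_mem_generatedOn hm _), ?_⟩
  rw [map_mul, Module.End.mul_apply, std_torus_single, torusEntry_cochar_self, map_smul, e,
    Units.val_mk0, smul_inv_smul₀ hvm]

/-- The generators supported on at least two positions act transitively on the nonzero isotropic
vectors supported there. -/
theorem exists_std_single_eq_of_isotropic {K : Set (Fin n)} {m : Idx n} (hm : pos m ∈ K)
    {j : Fin n} (hj : j ∈ K) (hjm : j ≠ pos m) {v : Idx n → ℂ} (hv : bil v v = 0) (hv0 : v ≠ 0)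
    (hK : ∀ c, pos c ∉ K → v c = 0) :
    ∃ h ∈ generatedOn K, std n h (Pi.single m 1) = v := by
  have move : ∀ g ∈ generatedOn K, ∀ v : Idx n → ℂ,
      (∃ h ∈ generatedOn K, std n h (Pi.single m 1) = std n g v) →
      ∃ h ∈ generatedOn K, std n h (Pi.single m 1) = v := by
    rintro g hg v ⟨h, hh, e⟩
    refine ⟨g⁻¹ * h, mul_mem (inv_mem hg) hh, ?_⟩
    rw [map_mul, Module.End.mul_apply, e, Representation.inv_self_apply]
  -- The generators fix every basis vector outside `K`, so pairing with those vectors shows that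
  -- supports inside `K` are preserved.
  have supp : ∀ g ∈ generatedOn K, ∀ v : Idx n → ℂ, (∀ c, pos c ∉ K → v c = 0) →
      ∀ c, pos c ∉ K → std n g v c = 0 := by
    intro g hg v hK c hc
    have h1 := generatedOn_le_fixer (c := c.swap) (by rwa [pos_swap]) hg
    rw [mem_fixer] at h1
    have h2 := bil_std g v (Pi.single c.swap 1)
    rw [h1, bil_single_right, bil_single_right, Sum.swap_swap, hK c hc] at h2
    simpa using h2
  have mid : ∀ v : Idx n → ℂ, bil v v = 0 → (∀ c, pos c ∉ K → v c = 0) → v m = 0 →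
      ∀ b, pos b ≠ pos m → v b ≠ 0 → ∃ h ∈ generatedOn K, std n h (Pi.single m 1) = v := by
    intro v hv hK hvm b hbm hvb
    have hb : pos b ∈ K := by_contra fun h => hvb (hK b h)
    have hg := rootElement_mem_generatedOn (ne_of_pos_ne hbm.symm) 1 hbm.symm hm hb
    refine move _ hg v (exists_std_single_eq_of_coord_ne_zero hm (by rw [bil_std, hv]) ?_
      (supp _ hg v hK))
    rw [std_rootElement]
    simpa [hvm, ne_swap_of_pos_ne hbm.symm] using hvb
  by_cases hvm : v m = 0
  swap
  · exact exists_std_single_eq_of_coord_ne_zero hm hv hvm hK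
  by_cases hex : ∃ b, pos b ≠ pos m ∧ v b ≠ 0
  · obtain ⟨b, hb, hvb⟩ := hex
    exact mid v hv hK hvm b hb hvb
  push Not at hex
  -- The remaining case is a multiple of `e_{m.swap}`. Within one plane it cannot be moved to `e_m`,
  -- so a second position `j` is used as an intermediate stop.
  have hsw : v m.swap ≠ 0 := by
    intro h
    apply hv0
    ext c
    by_cases hc : pos c = pos m
    · rcases eq_or_eq_swap_of_pos_eq hc with rfl | rfl
      exacts [hvm, h]
    · exact hex c hc
  have hp : pos (Sum.inl j : Idx n) ≠ pos m.swap := by simpa using hjm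
  have hp' : pos (Sum.inl j : Idx n) ≠ pos m := hjm
  have hg := rootElement_mem_generatedOn (ne_of_pos_ne hp) 1 hp hj (by simpa using hm)
  refine move _ hg v (mid _ (by rw [bil_std, hv]) (supp _ hg v hK) ?_ (Sum.inl j) hp' ?_)
  · rw [std_rootElement]
    have h1 := hex (Sum.inr j) hjm
    simp [hvm, (ne_of_pos_ne hp').symm, h1]
  · rw [std_rootElement]
    have h1 := hex (Sum.inl j) hjm
    simp [h1, hsw, ne_of_pos_ne hp']

/-! ### Generation of pointwise stabilizers by torus and root elements. -/

theorem eq_of_std_single {g h : SO n}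
    (H : ∀ c, std n g (Pi.single c 1) = std n h (Pi.single c 1)) : g = h := by
  apply Subtype.ext
  apply Subtype.ext
  ext a c
  rw [← std_single, ← std_single, H]

/-- The coordinate at `d.swap` is the pairing with `e_d`, which `g` fixes, so it is the same before
and after applying `g`. -/
theorem coord_eq_zero_of_fixed {g : SO n} {c d : Idx n} (hd : std n g (Pi.single d 1) =
    Pi.single d 1) (hcd : c ≠ d.swap) : std n g (Pi.single c 1) d.swap = 0 := by
  have := bil_std g (Pi.single c 1) (Pi.single d 1)
  rw [hd, bil_single_right, bil_single_right, Pi.single_eq_of_ne hcd.symm] at this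
  simpa using this

/-- `SO(2, ℂ)` is a torus: an element that moves only one hyperbolic plane lies in the torus. -/
theorem exists_eq_torus {m : Fin n} {g : SO n}
    (hg : ∀ c : Idx n, pos c ≠ m → std n g (Pi.single c 1) = Pi.single c 1) :
    ∃ z : ℂˣ, g = torus (cochar (Sum.inl m) z) := by
  have hdet : g.1.1.det = 1 := g.1.2
  have hoff : ∀ c d : Idx n, pos c = m → pos d ≠ m → std n g (Pi.single c 1) d = 0 := by
    intro c d hc hd
    have := coord_eq_zero_of_fixed (g := g) (c := c) (d := d.swap) (hg _ (by rwa [pos_swap]))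
      (by rw [Sum.swap_swap]; rintro rfl; exact hd hc)
    rwa [Sum.swap_swap] at this
  set p : Idx n := Sum.inl m with hp
  set q : Idx n := Sum.inr m with hq
  set α := std n g (Pi.single p 1) p with hα
  set β := std n g (Pi.single p 1) q with hβ
  set γ := std n g (Pi.single q 1) p with hγ
  set δ := std n g (Pi.single q 1) q with hδ
  have hbil : ∀ c d : Idx n, pos c = m → bil (std n g (Pi.single c 1)) (std n g (Pi.single d 1)) =
      std n g (Pi.single c 1) p * std n g (Pi.single d 1) q +
      std n g (Pi.single c 1) q * std n g (Pi.single d 1) p := by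
    intro c d hc
    rw [bil, Fintype.sum_eq_add p q (by simp [hp, hq])]
    · rfl
    · rintro x ⟨h1, h2⟩
      rw [hoff c x hc, zero_mul]
      rcases x with i | i <;> simp_all
  have e1 : α * β + β * α = 0 := by rw [← hbil p p rfl, bil_std, bil_single_self]
  have e2 : γ * δ + δ * γ = 0 := by rw [← hbil q q rfl, bil_std, bil_single_self]
  have e3 : α * δ + β * γ = 1 := by
    rw [← hbil p q rfl, bil_std, bil_single_right, show q.swap = p from rfl]
    simp
  have ep : ∀ d, std n g (Pi.single p 1) d = (α • Pi.single p 1 + β • Pi.single q 1 :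
      Idx n → ℂ) d := by
    intro d
    by_cases hd : pos d = m
    · rcases d with i | i
      · obtain rfl : i = m := hd
        simp [hp, hq, hα]
      · obtain rfl : i = m := hd
        simp [hp, hq, hβ]
    · rw [hoff p d rfl hd]
      have h1 : d ≠ p := by rintro rfl; exact hd rfl
      have h2 : d ≠ q := by rintro rfl; exact hd rfl
      simp [h1, h2]
  have eq' : ∀ d, std n g (Pi.single q 1) d = (γ • Pi.single p 1 + δ • Pi.single q 1 :
      Idx n → ℂ) d := by
    intro d
    by_cases hd : pos d = m
    · rcases d with i | i
      · obtain rfl : i = m := hd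
        simp [hp, hq, hγ]
      · obtain rfl : i = m := hd
        simp [hp, hq, hδ]
    · rw [hoff q d rfl hd]
      have h1 : d ≠ p := by rintro rfl; exact hd rfl
      have h2 : d ≠ q := by rintro rfl; exact hd rfl
      simp [h1, h2]
  -- The form equations leave a diagonal or an antidiagonal block on the plane. The antidiagonal one
  -- is a reflection, of determinant `-1`, and is excluded by `hdet`.
  by_cases h0 : α = 0
  · exfalso
    rw [h0, zero_mul, zero_add] at e3
    have hγ0 : γ ≠ 0 := right_ne_zero_of_mul_eq_one e3
    have hδ0 : δ = 0 := by
      have : 2 * γ * δ = 0 := by linear_combination e2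
      simpa [hγ0] using this
    -- A reflection is a rank-one perturbation of the identity, so its determinant follows from the
    -- formula for `det (1 + u vᵀ)`.
    have hmat : g.1.1 = 1 + replicateCol Unit (Pi.single p 1 - β • Pi.single q 1) *
        replicateRow Unit (γ • Pi.single q 1 - Pi.single p 1) := by
      ext d c
      rw [← std_single, Matrix.add_apply, Matrix.mul_apply]
      simp only [Finset.univ_unique, Finset.sum_singleton, replicateCol_apply, replicateRow_apply]
      by_cases hc : pos c = m
      · rcases c with i | i
        · obtain rfl : i = m := hc
          rw [ep, h0]
          simp only [Matrix.one_apply, Pi.single_apply, hp, hq, Pi.add_apply, Pi.sub_apply,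
            Pi.smul_apply, smul_eq_mul]
          simp
        · obtain rfl : i = m := hc
          rw [eq', hδ0]
          simp only [Matrix.one_apply, Pi.single_apply, hp, hq, Pi.add_apply, Pi.sub_apply,
            Pi.smul_apply, smul_eq_mul]
          simp [sub_mul, ite_mul, e3]
      · have h1 : c ≠ p := by rintro rfl; exact hc rfl
        have h2 : c ≠ q := by rintro rfl; exact hc rfl
        rw [hg c hc]
        simp [h1, h2, Pi.single_apply, Matrix.one_apply]
    rw [hmat, det_one_add_replicateCol_mul_replicateRow] at hdet
    simp only [dotProduct_sub, dotProduct_smul, dotProduct_single] at hdet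
    simp [hp, hq] at hdet
    have : (2 : ℂ) = 0 := by linear_combination -e3 - hdet
    norm_num at this
  · have hβ0 : β = 0 := by
      have : 2 * α * β = 0 := by linear_combination e1
      simpa [h0] using this
    rw [hβ0, zero_mul, add_zero] at e3
    have hδ0 : δ ≠ 0 := right_ne_zero_of_mul_eq_one e3
    have hγ0 : γ = 0 := by
      have : 2 * δ * γ = 0 := by linear_combination e2
      simpa [hδ0] using this
    refine ⟨Units.mk0 α h0, eq_of_std_single fun c => ?_⟩
    rw [std_torus_single]
    by_cases hc : pos c = m
    · rcases c with i | i
      · obtain rfl : i = m := hc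
        rw [torusEntry_cochar_self, Units.val_mk0]
        ext d
        rw [ep, hβ0]
        simp [hp]
      · obtain rfl : i = m := hc
        have := torusEntry_swap (cochar (Sum.inl i) (Units.mk0 α h0)) (Sum.inl i)
        rw [Sum.swap_inl] at this
        rw [this, torusEntry_cochar_self]
        ext d
        rw [eq', hγ0, eq_inv_of_mul_eq_one_right e3]
        simp [hq]
    · rw [torusEntry_cochar_of_ne hc, hg c hc]
      simp

/-- An element that fixes the basis vectors outside a set of positions is a product of generators
supported on that set. -/
theorem mem_generatedOn_of_fixed (K : Finset (Fin n)) (g : SO n)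
    (hg : ∀ c : Idx n, pos c ∉ K → std n g (Pi.single c 1) = Pi.single c 1) :
    g ∈ generatedOn (K : Set (Fin n)) := by
  induction K using Finset.induction_on generalizing g with
  | empty =>
    have : g = 1 := eq_of_std_single fun c => by
      rw [hg c (by simp), map_one, Module.End.one_apply]
    rw [this]
    exact one_mem _
  | insert m K hmK ih =>
    -- A single position is the case of `SO(2)`, where transitivity on isotropic vectors fails; it
    -- is handled by `exists_eq_torus`.
    rcases K.eq_empty_or_nonempty with rfl | ⟨j, hj⟩
    · obtain ⟨z, rfl⟩ := exists_eq_torus (m := m) (g := g) fun c hc => hg c (by simpa using hc)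
      exact cochar_mem_generatedOn (by simp) z
    set L : Set (Fin n) := ((insert m K : Finset (Fin n)) : Set (Fin n)) with hL
    have hmL : m ∈ L := by simp [hL]
    set p : Idx n := Sum.inl m with hp
    have supp : ∀ g' : SO n, (∀ c : Idx n, pos c ∉ L → std n g' (Pi.single c 1) = Pi.single c 1) →
        ∀ c : Idx n, pos c ∈ L → ∀ d, pos d ∉ L → std n g' (Pi.single c 1) d = 0 := by
      intro g' hg' c hc d hd
      have := coord_eq_zero_of_fixed (g := g') (c := c) (d := d.swap)
        (hg' _ (by rwa [pos_swap])) (by rw [Sum.swap_swap]; rintro rfl; exact hd hc)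
      rwa [Sum.swap_swap] at this
    obtain ⟨h₁, hh₁, e₁⟩ := exists_std_single_eq_of_isotropic (K := L) (m := p) hmL
      (j := j) (by simp [hL, hj]) (by rintro rfl; exact hmK hj)
      (v := std n g (Pi.single p 1)) (by rw [bil_std, bil_single_self])
      (fun h => by
        have : std n g⁻¹ (std n g (Pi.single p 1)) = 0 := by rw [h, map_zero]
        rw [Representation.inv_self_apply] at this
        simpa using congrFun this p)
      (supp g hg p hmL)
    set g₁ := h₁⁻¹ * g with hg₁
    have fix₁ : ∀ c : Idx n, pos c ∉ L → std n g₁ (Pi.single c 1) = Pi.single c 1 := fun c hc =>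
      mem_fixer.1 (mul_mem (inv_mem (generatedOn_le_fixer hc hh₁)) (mem_fixer.2 (hg c hc)))
    have fixp : std n g₁ (Pi.single p 1) = Pi.single p 1 := by
      rw [hg₁, map_mul, Module.End.mul_apply, std_eq_of_inv e₁]
    -- After `h₁` has corrected the image of `e_p`, the image of `e_{p.swap}` is corrected by
    -- elements that fix `e_p`. What remains fixes the whole plane of `m`, and the induction
    -- hypothesis applies to it.
    obtain ⟨h₂, ⟨hh₂, hh₂'⟩, e₂⟩ := exists_std_single_eq
      (generatedOn L ⊓ fixer (Pi.single p 1)).toSubmonoid p.swap (std n g₁ (Pi.single p.swap 1))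
      (by rw [bil_std, bil_single_self])
      (by
        have := bil_std g₁ (Pi.single p.swap 1) (Pi.single p 1)
        rw [fixp, bil_single_right, bil_single_right] at this
        simpa using this)
      (by
        intro a hac s hpa ha
        refine ⟨rootElement_mem_generatedOn hac s hpa ?_ hmL,
          rootElement_mem_fixer_single hac s (ne_swap_self p).symm ?_⟩
        · exact by_contra fun h => ha (supp g₁ fix₁ p.swap hmL a h)
        · intro h
          apply hpa
          rw [← h, Sum.swap_swap])
    have hg₂ : h₂⁻¹ * g₁ ∈ generatedOn (K : Set (Fin n)) := by
      refine ih _ fun c hc => ?_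
      by_cases hcm : pos c = m
      · rcases eq_or_eq_swap_of_pos_eq (b := p) hcm with rfl | rfl
        · exact mem_fixer.1 (mul_mem (inv_mem hh₂') (mem_fixer.2 fixp))
        · rw [map_mul, Module.End.mul_apply, std_eq_of_inv e₂]
      · have hcL : pos c ∉ L := by simp [hL, hcm, hc]
        exact mem_fixer.1 (mul_mem (inv_mem (generatedOn_le_fixer hcL hh₂))
          (mem_fixer.2 (fix₁ c hcL)))
    have hfinal : g = h₁ * (h₂ * (h₂⁻¹ * g₁)) := by rw [hg₁]; group
    rw [hfinal]
    exact mul_mem hh₁ (mul_mem hh₂ (generatedOn_mono (by simp [hL]) hg₂))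

/-! ### The stabilizer of the line through `e_m` lies in the parabolic. -/

/-- The roots of the parabolic subgroup attached to `l_m` do not move the basis vector `e_m`. -/
theorem root_fixes_of_pairing_nonneg {m : Fin n} {a b : Idx n} (hab : a ≠ b)
    (h : a ≠ b.swap)
    (hpos : 0 ≤ (Pi.single m 1 : Weight n) ⬝ᵥ (wt a - wt b)) :
    b ≠ Sum.inl m ∧ a.swap ≠ Sum.inl m := by
  have hp := pos_ne_of_ne hab h
  rw [single_dotProduct, one_mul] at hpos
  constructor
  · rintro rfl
    rcases a with i | i <;> simp_all [wt, eq_comm]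
  · intro h'
    rcases a with i | i
    · simp at h'
    · rcases b with j | j <;> simp_all [wt, eq_comm]

theorem torus_mem_parabolic (lam : Weight n) (t : Fin n → ℂˣ) : torus t ∈ parabolic lam :=
  Subgroup.subset_closure (Or.inl ⟨t, rfl⟩)

theorem rootElement_mem_parabolic {lam : Weight n} {a b : Idx n} (hab : a ≠ b) (s : ℂ)
    (h : pos a ≠ pos b) (hpos : 0 ≤ lam ⬝ᵥ (wt a - wt b)) :
    rootElement a b hab s ∈ parabolic lam :=
  Subgroup.subset_closure (Or.inr ⟨a, b, hab, s, ne_swap_of_pos_ne h, hpos, rfl⟩)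

/-- The stabilizer of the line through `e_m` is contained in the parabolic subgroup attached to
`l_m`. -/
theorem mem_parabolic_of_std_eq_smul {m : Fin n} {g : SO n} {x : ℂ}
    (hg : std n g (Pi.single (Sum.inl m) 1) = x • Pi.single (Sum.inl m) 1) :
    g ∈ parabolic (Pi.single m 1 : Weight n) := by
  set p : Idx n := Sum.inl m with hp
  set P := parabolic (Pi.single m 1 : Weight n) with hP
  have hx : x ≠ 0 := by
    rintro rfl
    have : std n g⁻¹ (std n g (Pi.single p 1)) = 0 := by rw [hg, zero_smul, map_zero]
    rw [Representation.inv_self_apply] at this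
    simpa using congrFun this p
  have hwt : ∀ a : Idx n, pos a ≠ m → (Pi.single m 1 : Weight n) ⬝ᵥ wt a = 0 := by
    intro a ha
    rw [single_dotProduct, one_mul]
    rcases a with i | i <;> simp_all [wt, eq_comm]
  set z := Units.mk0 x hx with hz
  set τ := torus (cochar p z) with hτ
  have hτP : τ ∈ P := torus_mem_parabolic _ _
  have fixp : std n (g * τ⁻¹) (Pi.single p 1) = Pi.single p 1 := by
    have : std n τ⁻¹ (x • Pi.single p 1) = Pi.single p 1 := by
      apply std_eq_of_inv
      rw [hτ, std_torus_single, torusEntry_cochar_self, hz, Units.val_mk0]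
    rw [map_smul] at this
    rw [map_mul, Module.End.mul_apply, ← inv_smul_smul₀ hx (std n τ⁻¹ _), this, map_smul, hg,
      inv_smul_smul₀ hx]
  set g₁ := g * τ⁻¹ with hg₁
  obtain ⟨h₂, ⟨hh₂, hh₂'⟩, e₂⟩ := exists_std_single_eq
    (P ⊓ fixer (Pi.single p 1)).toSubmonoid p.swap (std n g₁ (Pi.single p.swap 1))
    (by rw [bil_std, bil_single_self])
    (by
      have := bil_std g₁ (Pi.single p.swap 1) (Pi.single p 1)
      rw [fixp, bil_single_right, bil_single_right] at this
      simpa using this)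
    (by
      intro a hac s hpa ha
      refine ⟨rootElement_mem_parabolic hac s hpa ?_,
        rootElement_mem_fixer_single hac s (ne_swap_self p).symm ?_⟩
      -- The roots used here pair to `0 - (-1) = 1` with `l_m`: they belong to the unipotent
      -- radical.
      · rw [dotProduct_sub, hwt a (by simpa [hp] using hpa)]
        simp [hp, wt]
      · intro h
        apply hpa
        rw [← h, Sum.swap_swap])
  have hg₂ : h₂⁻¹ * g₁ ∈ P := by
    -- The generators away from position `m` are torus elements and roots orthogonal to `l_m`, hence
    -- lie in the Levi part.
    have hle : generatedOn (((Finset.univ.erase m : Finset (Fin n))) : Set (Fin n)) ≤ P := by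
      refine generatedOn_le (fun t _ => torus_mem_parabolic _ t) ?_
      intro a b hab s hpab ha hb
      refine rootElement_mem_parabolic hab s hpab ?_
      rw [dotProduct_sub, hwt a (by simpa using ha), hwt b (by simpa using hb), sub_zero]
    refine hle (mem_generatedOn_of_fixed _ _ fun c hc => ?_)
    have hcm : pos c = pos p := by simpa [hp] using hc
    rcases eq_or_eq_swap_of_pos_eq hcm with rfl | rfl
    · exact mem_fixer.1 (mul_mem (inv_mem hh₂') (mem_fixer.2 fixp))
    · rw [map_mul, Module.End.mul_apply, std_eq_of_inv e₂]
  have hfinal : g = h₂ * (h₂⁻¹ * g₁) * τ := by rw [hg₁]; group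
  rw [hfinal]
  exact mul_mem (mul_mem hh₂ hg₂) hτP

/-! ### Polynomial curves and opposite root subgroups. -/

/-- A curve in `SO(2n, ℂ)` whose matrix entries are polynomials in the parameter. -/
def IsPolynomialCurve (γ : ℂ → SO n) : Prop :=
  ∀ a b, ∃ p : Polynomial ℂ, ∀ s, (γ s).1.1 a b = p.eval s

theorem isPolynomialCurve_const (g : SO n) : IsPolynomialCurve fun _ => g :=
  fun a b => ⟨Polynomial.C (g.1.1 a b), fun s => by simp⟩

theorem IsPolynomialCurve.mul {γ δ : ℂ → SO n} (hγ : IsPolynomialCurve γ)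
    (hδ : IsPolynomialCurve δ) : IsPolynomialCurve fun s => γ s * δ s := by
  intro a b
  choose p hp using hγ
  choose q hq using hδ
  refine ⟨∑ c, p a c * q c b, fun s => ?_⟩
  change ((γ s).1.1 * (δ s).1.1) a b = _
  rw [Matrix.mul_apply, Polynomial.eval_finsetSum]
  exact Finset.sum_congr rfl fun c _ => by rw [hp, hq, Polynomial.eval_mul]

theorem isPolynomialCurve_rootElement {a b : Idx n} (hab : a ≠ b) (x : ℂ) :
    IsPolynomialCurve fun s => rootElement a b hab (s * x) := by
  intro c d
  refine ⟨Polynomial.C ((1 : Matrix (Idx n) (Idx n) ℂ) c d) + Polynomial.X *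
    Polynomial.C (x * (single a b 1 - single b.swap a.swap 1 : Matrix (Idx n) (Idx n) ℂ) c d),
    fun s => ?_⟩
  change (1 + (s * x) • (single a b 1 - single b.swap a.swap 1) : Matrix (Idx n) (Idx n) ℂ) c d = _
  simp [mul_assoc]

variable {V : Type*} [AddCommGroup V] [Module ℂ V] {ρ : Representation ℂ (SO n) V}

theorem IsAlgebraicRep.exists_polynomial (hρ : IsAlgebraicRep ρ) {γ : ℂ → SO n}
    (hγ : IsPolynomialCurve γ) (v : V) (φ : Module.Dual ℂ V) :
    ∃ p : Polynomial ℂ, ∀ s, φ (ρ (γ s) v) = p.eval s := by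
  obtain ⟨P, hP⟩ := hρ v φ
  choose p hp using hγ
  refine ⟨aeval (fun ij : Idx n × Idx n => p ij.1 ij.2) P, fun s => ?_⟩
  rw [hP, ← Polynomial.coe_evalRingHom, aeval_def, MvPolynomial.hom_eval₂]
  rw [MvPolynomial.eval, coe_eval₂Hom]
  congr 1
  · ext x; simp
  · ext ij; exact hp _ _ _

theorem isAlgebraicRep_std : IsAlgebraicRep (std n) := by
  intro v φ
  refine ⟨∑ a, ∑ b, C (v b * φ (Pi.single a 1)) * X (a, b), fun g => ?_⟩
  have : std n g v = ∑ a, (∑ b, g.1.1 a b * v b) • (Pi.single a 1 : Idx n → ℂ) := by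
    ext c
    simp [std_apply, Matrix.mulVec, dotProduct, Finset.sum_apply, Pi.single_apply]
  rw [this, map_sum, map_sum]
  refine Finset.sum_congr rfl fun a _ => ?_
  rw [map_smul, smul_eq_mul, Finset.sum_mul, map_sum]
  refine Finset.sum_congr rfl fun b _ => ?_
  simp only [map_mul, eval_C, eval_X]
  change g.1.1 a b * v b * _ = _ * g.1.1 a b
  ring

/-- The Bruhat relation in the copy of `SL(2, ℂ)` attached to a root. -/
theorem rootElement_mul_rootElement {a b : Idx n} (hp : pos a ≠ pos b) (x y : ℂ) (z : ℂˣ)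
    (hz : (z : ℂ) = 1 + x * y) :
    rootElement a b (ne_of_pos_ne hp) x * rootElement b a (ne_of_pos_ne hp.symm) y =
      rootElement b a (ne_of_pos_ne hp.symm) (y / z) *
        (torus (cochar a z * cochar b z⁻¹) * rootElement a b (ne_of_pos_ne hp) (x / z)) := by
  have hab := ne_of_pos_ne hp
  have hab' := ne_swap_of_pos_ne hp
  have hba' := ne_swap_of_pos_ne hp.symm
  have ha := ne_swap_self a
  have hb := ne_swap_self b
  have hs : a.swap ≠ b.swap := fun h => hab (Sum.swap_leftInverse.injective h)
  have hz0 : (1 + x * y : ℂ) ≠ 0 := hz ▸ z.ne_zero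
  have hz1 : (1 + y * x : ℂ) ≠ 0 := mul_comm x y ▸ hz0
  have ta : torusEntry (cochar a z * cochar b z⁻¹) a = z := by
    rw [torusEntry_mul, torusEntry_cochar_self, torusEntry_cochar_of_ne hp, mul_one]
  have tb : torusEntry (cochar a z * cochar b z⁻¹) b = z⁻¹ := by
    rw [torusEntry_mul, torusEntry_cochar_self, torusEntry_cochar_of_ne hp.symm, one_mul]
  have ta' := torusEntry_swap (cochar a z * cochar b z⁻¹) a
  have tb' := torusEntry_swap (cochar a z * cochar b z⁻¹) b
  rw [ta] at ta'
  rw [tb, inv_inv] at tb'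
  refine std_injective fun v => ?_
  simp only [map_mul, Module.End.mul_apply]
  ext d
  by_cases hda : d = a ∨ d = b ∨ d = a.swap ∨ d = b.swap
  · rcases hda with rfl | rfl | rfl | rfl <;>
      simp [std_rootElement, std_torus, ta, tb, ta', tb', hab, hab', hba', ha, hb, hs,
        hab.symm, hab'.symm, hba'.symm, ha.symm, hb.symm, hs.symm, hz] <;>
      field_simp <;> ring
  · push Not at hda
    obtain ⟨hda, hdb, hda', hdb'⟩ := hda
    have hd : torusEntry (cochar a z * cochar b z⁻¹) d = 1 := by
      rw [torusEntry_mul, torusEntry_cochar_of_ne (pos_ne_of_ne hda hda'),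
        torusEntry_cochar_of_ne (pos_ne_of_ne hdb hdb'), one_mul]
    simp [std_rootElement, std_torus, hd, hda, hdb, hda', hdb']

/-- A function polynomial in both `z` and `z⁻¹` is constant. Clearing denominators gives `p.reverse
= X ^ p.natDegree * r`, and comparing degrees forces `r` to be constant. -/
theorem eval_eq_of_eval_inv_eq {p r : Polynomial ℂ}
    (h : ∀ z : ℂ, z ≠ 0 → p.eval z⁻¹ = r.eval z) (s : ℂ) : p.eval s = p.eval 0 := by
  have hrev : p.reverse = Polynomial.X ^ p.natDegree * r := by
    refine Polynomial.eq_of_infinite_eval_eq _ _ (Set.Infinite.mono ?_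
      (Set.finite_singleton (0 : ℂ)).infinite_compl)
    intro z hz
    have hz : z ≠ 0 := hz
    let : Invertible z⁻¹ := ⟨z, mul_inv_cancel₀ hz, inv_mul_cancel₀ hz⟩
    have e : p.reverse.eval z * z⁻¹ ^ p.natDegree = p.eval z⁻¹ :=
      Polynomial.eval₂_reverse_mul_pow (RingHom.id ℂ) z⁻¹ p
    rw [h z hz] at e
    change p.reverse.eval z = _
    rw [Polynomial.eval_mul, Polynomial.eval_pow, Polynomial.eval_X, ← e, mul_left_comm,
      ← mul_pow, mul_inv_cancel₀ hz, one_pow, mul_one]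
  have hr : r = Polynomial.C (r.coeff 0) := by
    by_cases hr0 : r = 0
    · simp [hr0]
    · refine Polynomial.eq_C_of_natDegree_eq_zero ?_
      have hd := Polynomial.reverse_natDegree_le p
      rw [hrev, Polynomial.natDegree_X_pow_mul p.natDegree hr0] at hd
      omega
  have hpc : p = Polynomial.C (r.coeff 0) := by
    refine Polynomial.eq_of_infinite_eval_eq _ _ (Set.Infinite.mono ?_
      (Set.finite_singleton (0 : ℂ)).infinite_compl)
    intro z hz
    have := h z⁻¹ (inv_ne_zero hz)
    rw [inv_inv, hr] at this
    simpa using this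
  rw [hpc, Polynomial.eval_C, Polynomial.eval_C]

/-- If the root subgroup of `α` and the image of the coroot fix a vector, then so does the root
subgroup of `-α`. -/
theorem opposite_rootElement_fixes (hρ : IsAlgebraicRep ρ) {a b : Idx n} (hp : pos a ≠ pos b)
    {w : V} (hw : ∀ s, ρ (rootElement a b (ne_of_pos_ne hp) s) w = w)
    (ht : ∀ z : ℂˣ, ρ (torus (cochar a z * cochar b z⁻¹)) w = w) (s : ℂ) :
    ρ (rootElement b a (ne_of_pos_ne hp.symm) s) w = w := by
  rw [← sub_eq_zero, ← Module.forall_dual_apply_eq_zero_iff ℂ]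
  intro φ
  obtain ⟨p, hP⟩ := hρ.exists_polynomial
    (isPolynomialCurve_rootElement (ne_of_pos_ne hp.symm) 1) w φ
  obtain ⟨r, hR⟩ := hρ.exists_polynomial (isPolynomialCurve_rootElement (ne_of_pos_ne hp) 1)
    (ρ (rootElement b a (ne_of_pos_ne hp.symm) 1) w) φ
  simp only [mul_one] at hP hR
  -- The Bruhat relation with `x = z - 1`, `y = 1` is applied to `w`: its torus and `α`-factors fix
  -- `w`, leaving the `-α` element with parameter `1 / z`. The left-hand side is polynomial in `z`.
  have key : ∀ z : ℂ, z ≠ 0 →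
      p.eval z⁻¹ = (r.comp (Polynomial.X - Polynomial.C 1)).eval z := by
    intro z hz
    rw [Polynomial.eval_comp, Polynomial.eval_sub, Polynomial.eval_X, Polynomial.eval_C, ← hP,
      ← hR, ← Module.End.mul_apply, ← map_mul,
      rootElement_mul_rootElement hp (z - 1) 1 (Units.mk0 z hz) (by simp), map_mul, map_mul,
      Module.End.mul_apply, Module.End.mul_apply, hw, ht]
    simp
  have h0 : ρ (rootElement b a (ne_of_pos_ne hp.symm) 0) w = w := by
    have : rootElement b a (ne_of_pos_ne hp.symm) 0 = 1 :=
      std_injective fun v => by rw [std_rootElement]; simp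
    rw [this, map_one, Module.End.one_apply]
  rw [map_sub, hP, eval_eq_of_eval_inv_eq key, ← hP, h0, sub_self]

/-! ### The parabolic acts on the highest weight line. -/

theorem isPositiveRoot_or {a b : Idx n} (hp : pos a ≠ pos b) :
    IsPositiveRoot (wt a - wt b) ∨ IsPositiveRoot (wt b - wt a) := by
  rcases a with i | i <;> rcases b with j | j <;> simp only [pos_inl, pos_inr] at hp <;>
    rcases lt_or_gt_of_ne hp with h | h
  · exact Or.inr ⟨j, i, h, Or.inr rfl⟩
  · exact Or.inl ⟨i, j, h, Or.inr rfl⟩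
  · exact Or.inl ⟨j, i, h, Or.inl (by simp [wt, add_comm])⟩
  · exact Or.inl ⟨i, j, h, Or.inl (by simp [wt])⟩
  · exact Or.inr ⟨j, i, h, Or.inl (by simp [wt])⟩
  · exact Or.inr ⟨i, j, h, Or.inl (by simp [wt, add_comm])⟩
  · exact Or.inl ⟨j, i, h, Or.inr (by simp [wt]; abel)⟩
  · exact Or.inr ⟨i, j, h, Or.inr (by simp [wt]; abel)⟩

theorem IsPositiveRoot.pairing_nonneg {m : Fin n} (hm : ∀ i, i ≤ m) {α : Weight n}
    (h : IsPositiveRoot α) : 0 ≤ (Pi.single m 1 : Weight n) ⬝ᵥ α := by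
  obtain ⟨i, j, hji, h⟩ := h
  have hj : m ≠ j := (hji.trans_le (hm i)).ne'
  rw [single_dotProduct, one_mul]
  rcases h with rfl | rfl <;> simp [Pi.single_apply, hj] <;> split_ifs <;> simp

theorem hasWeight_single {m : Fin n} {v : V} :
    HasWeight ρ (Pi.single m 1) v ↔ ∀ t : Fin n → ℂˣ, ρ (torus t) v = (t m : ℂ) • v := by
  refine forall_congr' fun t => ?_
  rw [Fintype.prod_eq_single m fun i hi => by simp [hi]]
  simp

theorem hasWeight_neg_single {m : Fin n} {v : V} :
    HasWeight ρ (-Pi.single m 1) v ↔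
      ∀ t : Fin n → ℂˣ, ρ (torus t) v = ((t m)⁻¹ : ℂˣ) • v := by
  refine forall_congr' fun t => ?_
  rw [Fintype.prod_eq_single m fun i hi => by simp [hi]]
  simp [Units.smul_def]

/-- The parabolic subgroup acts on the highest weight line and on the line through `e_m` through
the same character. -/
theorem parabolic_acts_on_lines (hρ : IsAlgebraicRep ρ) {m : Fin n} (hm : ∀ i, i ≤ m) {w : V}
    (hw : IsHighestWeightVector ρ (Pi.single m 1) w) {g : SO n}
    (hg : g ∈ parabolic (Pi.single m 1 : Weight n)) :
    ∃ x : ℂ, x ≠ 0 ∧ std n g (Pi.single (Sum.inl m) 1) = x • Pi.single (Sum.inl m) 1 ∧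
      ρ g w = x • w := by
  obtain ⟨-, hwt, hpos⟩ := hw
  rw [hasWeight_single] at hwt
  induction hg using Subgroup.closure_induction with
  | mem g hg =>
    rcases hg with ⟨t, rfl⟩ | ⟨a, b, hab, s, hab', hn, rfl⟩
    · exact ⟨t m, (t m).ne_zero, std_torus_single t _, hwt t⟩
    · have hp := pos_ne_of_ne hab hab'
      obtain ⟨h1, h2⟩ := root_fixes_of_pairing_nonneg hab hab' hn
      refine ⟨1, one_ne_zero, ?_, ?_⟩
      · rw [one_smul]
        exact rootElement_mem_fixer_single hab s h1 h2
      · rw [one_smul]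
        rcases isPositiveRoot_or hp with h | h
        · exact hpos a b hab s h
        · refine opposite_rootElement_fixes hρ hp.symm (fun s => hpos _ _ _ s h) ?_ s
          -- The opposite root is positive, so it pairs nonnegatively with the dominant weight
          -- `l_m`, as does the given root. Both pairings vanish, so position `m` is not involved
          -- and the coroot fixes `w`.
          have h0 := h.pairing_nonneg hm
          have heq : (wt a : Weight n) m = wt b m := by
            rw [single_dotProduct, one_mul, Pi.sub_apply] at h0 hn
            omega
          have : pos a ≠ m ∧ pos b ≠ m := by
            rcases a with i | i <;> rcases b with j | j <;>
              simp only [wt, Sum.elim_inl, Sum.elim_inr, Pi.single_apply, Pi.neg_apply, pos_inl,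
                pos_inr] at heq hp ⊢ <;> grind
          intro z
          rw [hwt, Pi.mul_apply, cochar_of_ne this.1.symm, cochar_of_ne this.2.symm]
          simp
  | one => exact ⟨1, one_ne_zero, by simp, by simp⟩
  | mul g h _ _ ihg ihh =>
    obtain ⟨x, hx, e1, e2⟩ := ihg
    obtain ⟨y, hy, f1, f2⟩ := ihh
    refine ⟨x * y, mul_ne_zero hx hy, ?_, ?_⟩
    · rw [map_mul, Module.End.mul_apply, f1, map_smul, e1, smul_smul, mul_comm]
    · rw [map_mul, Module.End.mul_apply, f2, map_smul, e2, smul_smul, mul_comm]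
  | inv g _ ih =>
    obtain ⟨x, hx, e1, e2⟩ := ih
    refine ⟨x⁻¹, inv_ne_zero hx, ?_, ?_⟩
    · rw [eq_inv_smul_iff₀ hx, ← map_smul, ← e1, Representation.inv_self_apply]
    · rw [eq_inv_smul_iff₀ hx, ← map_smul, ← e2, Representation.inv_self_apply]

/-! ### Contraction of the orbit by a one-parameter subgroup. -/

theorem exists_std_single_eq_univ {c : Idx n} {j : Fin n} (hj : j ≠ pos c) {v : Idx n → ℂ}
    (hv : bil v v = 0) (hv0 : v ≠ 0) : ∃ g : SO n, std n g (Pi.single c 1) = v := by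
  obtain ⟨g, -, h⟩ := exists_std_single_eq_of_isotropic (K := Set.univ) (m := c)
    (Set.mem_univ _) (Set.mem_univ j) hj hv hv0 fun _ h => absurd (Set.mem_univ _) h
  exact ⟨g, h⟩

/-- Conjugation by the inverse of `cochar c s` multiplies the root parameter by `s`, because the
root is `wt a - wt c`; the conjugate therefore tends to the identity as `s → 0`. -/
theorem torus_inv_mul_rootElement {a c : Idx n} (hp : pos a ≠ pos c) (x : ℂ) (s : ℂˣ) :
    (torus (cochar c s))⁻¹ * rootElement a c (ne_of_pos_ne hp) x =
      rootElement a c (ne_of_pos_ne hp) (s * x) * (torus (cochar c s))⁻¹ := by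
  rw [inv_mul_eq_iff_eq_mul, ← mul_assoc, eq_mul_inv_iff_mul_eq]
  have hac := ne_of_pos_ne hp
  have hac' := ne_swap_of_pos_ne hp
  have hca' := ne_swap_of_pos_ne hp.symm
  have ha := ne_swap_self a
  have hc := ne_swap_self c
  have hs : a.swap ≠ c.swap := fun h => hac (Sum.swap_leftInverse.injective h)
  have ta : torusEntry (cochar c s) a = 1 := torusEntry_cochar_of_ne hp s
  have ta' : torusEntry (cochar c s) a.swap = 1 :=
    torusEntry_cochar_of_ne (by rwa [pos_swap]) s
  have tc := torusEntry_cochar_self c s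
  have tc' := torusEntry_swap (cochar c s) c
  rw [tc] at tc'
  refine std_injective fun v => ?_
  simp only [map_mul, Module.End.mul_apply]
  ext d
  by_cases hda : d = a
  · subst hda
    simp [std_rootElement, std_torus, ta, tc, hac']
    ring
  by_cases hdc : d = c.swap
  · subst hdc
    simp [std_rootElement, std_torus, ta', tc', hac'.symm]
    field_simp
  · simp [std_rootElement, std_torus, hda, hdc]

/-- On the big cell, the contraction by the one-parameter subgroup `cochar` extends to a
polynomial curve through the highest weight vector. -/
theorem exists_contracting_curve (hρ : IsAlgebraicRep ρ) {m : Fin n} (hm : ∀ i, i ≤ m) {w : V}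
    (hw : IsHighestWeightVector ρ (Pi.single m 1) w) (g : SO n) {x : ℂ} (hx : x ≠ 0)
    (hg : std n g (Pi.single (Sum.inl m) 1) (Sum.inl m) = x) :
    ∃ γ : ℂ → SO n, IsPolynomialCurve γ ∧ γ 0 = 1 ∧ ∀ s : ℂˣ,
      (s : ℂ) • ρ (torus (cochar (Sum.inl m) s))⁻¹ (ρ g w) = x • ρ (γ s) w := by
  set p : Idx n := Sum.inl m with hp
  -- `M` consists of the elements whose conjugates by the inverse torus element extend polynomially
  -- to `s = 0` with value `1` there.
  let M : Submonoid (SO n) :=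
    { carrier := {h | ∃ γ : ℂ → SO n, IsPolynomialCurve γ ∧ γ 0 = 1 ∧ ∀ s : ℂˣ,
        (torus (cochar p s))⁻¹ * h = γ s * (torus (cochar p s))⁻¹}
      one_mem' := ⟨fun _ => 1, isPolynomialCurve_const 1, rfl, fun s => by simp⟩
      mul_mem' := by
        rintro h k ⟨γ, hγ, hγ0, hγs⟩ ⟨δ, hδ, hδ0, hδs⟩
        refine ⟨_, hγ.mul hδ, by simp [hγ0, hδ0], fun s => ?_⟩
        rw [← mul_assoc, hγs, mul_assoc, hδs, mul_assoc] }
  obtain ⟨h, ⟨γ, hγ, hγ0, hγs⟩, e⟩ := exists_std_single_eq M p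
    (x⁻¹ • std n g (Pi.single p 1))
    (by rw [bil_smul_left, bil_smul_right, bil_std, bil_single_self, mul_zero, mul_zero])
    (by rw [Pi.smul_apply, hg, smul_eq_mul, inv_mul_cancel₀ hx])
    (fun a hac y hpa _ => ⟨fun s => rootElement a p hac (s * y),
      isPolynomialCurve_rootElement hac y,
      std_injective fun v => by rw [std_rootElement]; simp,
      torus_inv_mul_rootElement hpa y⟩)
  -- `h` and `g` agree on the line through `e_p`, so they differ by an element of the parabolic,
  -- which scales `w` by the same factor `x`.
  have hst : std n (h⁻¹ * g) (Pi.single p 1) = x • Pi.single p 1 := by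
    have he := std_eq_of_inv e
    rw [map_smul] at he
    rw [map_mul, Module.End.mul_apply]
    conv_rhs => rw [← he, smul_inv_smul₀ hx]
  obtain ⟨y, -, e1, e2⟩ := parabolic_acts_on_lines hρ hm hw (mem_parabolic_of_std_eq_smul hst)
  obtain rfl : x = y := by
    have := congrFun (hst.symm.trans e1) p
    simpa [← hp] using this
  have hgw : ρ g w = x • ρ h w := by
    rw [← map_smul, ← e2, ← Module.End.mul_apply, ← map_mul, mul_inv_cancel_left]
  refine ⟨γ, hγ, hγ0, fun s => ?_⟩
  have hsw : (s : ℂ) • ρ (torus (cochar p s))⁻¹ w = w := by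
    have := hasWeight_single.1 hw.2.1 (cochar p s)
    have hs : cochar p s m = s := torusEntry_cochar_self p s
    rw [hs] at this
    rw [← map_smul, ← this, Representation.inv_self_apply]
  rw [hgw, map_smul, ← Module.End.mul_apply, ← map_mul, hγs, map_mul, Module.End.mul_apply,
    smul_comm, ← map_smul, hsw]

/-- A linear subspace that contains the points of an orbit on the open set where the coordinate of
`g e_m` at `e_m` is nonzero contains the whole orbit. -/
theorem orbit_mem_of_coord_ne_zero (hρ : IsAlgebraicRep ρ) {m j : Fin n} (hj : j ≠ m) (w : V)
    (N : Submodule ℂ (V × (Idx n → ℂ)))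
    (hN : ∀ g : SO n, std n g (Pi.single (Sum.inl m) 1) (Sum.inl m) ≠ 0 →
      (ρ g w, std n g (Pi.single (Sum.inl m) 1)) ∈ N) (g : SO n) :
    (ρ g w, std n g (Pi.single (Sum.inl m) 1)) ∈ N := by
  set p : Idx n := Sum.inl m with hp
  -- A functional vanishing on `N` is polynomial along this curve and zero for `s ≠ 0`, hence also
  -- zero at `s = 0`.
  have limit : ∀ (a b : Idx n) (hab : a ≠ b) (g : SO n),
      (∀ s : ℂ, s ≠ 0 → (ρ (rootElement a b hab s * g) w,
        std n (rootElement a b hab s * g) (Pi.single p 1)) ∈ N) →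
      (ρ g w, std n g (Pi.single p 1)) ∈ N := by
    intro a b hab g h
    by_contra hnot
    obtain ⟨Ψ, hΨ, hle⟩ := Submodule.exists_le_ker_of_notMem hnot
    have hcurve := (isPolynomialCurve_rootElement hab 1).mul (isPolynomialCurve_const g)
    obtain ⟨q, hq⟩ := hρ.exists_polynomial hcurve w (Ψ ∘ₗ LinearMap.inl ℂ _ _)
    obtain ⟨r, hr⟩ := isAlgebraicRep_std.exists_polynomial hcurve (Pi.single p 1)
      (Ψ ∘ₗ LinearMap.inr ℂ _ _)
    have hqr : ∀ s : ℂ, Ψ (ρ (rootElement a b hab s * g) w,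
        std n (rootElement a b hab s * g) (Pi.single p 1)) = (q + r).eval s := by
      intro s
      rw [Polynomial.eval_add, ← hq, ← hr, mul_one, LinearMap.comp_apply, LinearMap.comp_apply,
        ← map_add]
      simp
    have hzero : q + r = 0 := by
      refine Polynomial.eq_of_infinite_eval_eq _ _ (Set.Infinite.mono ?_
        (Set.finite_singleton (0 : ℂ)).infinite_compl)
      intro s hs
      change (q + r).eval s = (0 : Polynomial ℂ).eval s
      rw [← hqr, Polynomial.eval_zero]
      exact hle (h s hs)
    have h0 := hqr 0
    have hone : rootElement a b hab 0 = 1 :=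
      std_injective fun v => by rw [std_rootElement]; simp
    rw [hzero, Polynomial.eval_zero, hone, one_mul] at h0
    exact hΨ h0
  have mid : ∀ g : SO n, (∃ b, pos b ≠ m ∧ std n g (Pi.single p 1) b ≠ 0) →
      (ρ g w, std n g (Pi.single p 1)) ∈ N := by
    rintro g ⟨b, hb, hgb⟩
    by_cases hgp : std n g (Pi.single p 1) p = 0
    · have hpb : pos p ≠ pos b := hb.symm
      refine limit p b (ne_of_pos_ne hpb) g fun s hs => hN _ ?_
      rw [map_mul, Module.End.mul_apply, std_rootElement]
      simpa [hgp, ne_swap_of_pos_ne hpb, hs] using hgb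
    · exact hN g hgp
  by_cases hex : ∃ b, pos b ≠ m ∧ std n g (Pi.single p 1) b ≠ 0
  · exact mid g hex
  by_cases hgp : std n g (Pi.single p 1) p = 0
  swap
  · exact hN g hgp
  push Not at hex
  have hgp' : std n g (Pi.single p 1) p.swap ≠ 0 := by
    intro h
    have h0 : std n g (Pi.single p 1) = 0 := by
      ext c
      by_cases hc : pos c = pos p
      · rcases eq_or_eq_swap_of_pos_eq hc with rfl | rfl
        exacts [hgp, h]
      · exact hex c hc
    have := std_eq_of_inv h0
    rw [map_zero] at this
    simpa using congrFun this p
  have hjp : pos (Sum.inl j : Idx n) ≠ pos p.swap := by simpa [hp] using hj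
  have hjp' : pos (Sum.inl j : Idx n) ≠ pos p := hj
  refine limit (Sum.inl j) p.swap (ne_of_pos_ne hjp) g fun s hs => mid _ ⟨Sum.inl j, hj, ?_⟩
  rw [map_mul, Module.End.mul_apply, std_rootElement]
  have h1 := hex (Sum.inl j) hj
  simp [h1, hgp', ne_of_pos_ne hjp', hs]

/-! ### The orbit span as the graph of an isomorphism. -/

/-- The span of the orbit of `(w, e_m)` in `V × ℂ^{2n}`. -/
def orbitSpan (ρ : Representation ℂ (SO n) V) (w : V) (m : Fin n) :
    Submodule ℂ (V × (Idx n → ℂ)) :=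
  Submodule.span ℂ (Set.range fun g : SO n => (ρ g w, std n g (Pi.single (Sum.inl m) 1)))

theorem orbit_mem_orbitSpan (w : V) (m : Fin n) (g : SO n) :
    (ρ g w, std n g (Pi.single (Sum.inl m) 1)) ∈ orbitSpan ρ w m :=
  Submodule.subset_span ⟨g, rfl⟩

theorem orbitSpan_invariant {w : V} {m : Fin n} (g : SO n) {x : V × (Idx n → ℂ)}
    (hx : x ∈ orbitSpan ρ w m) : (ρ g x.1, std n g x.2) ∈ orbitSpan ρ w m := by
  induction hx using Submodule.span_induction with
  | mem x hx =>
    obtain ⟨h, rfl⟩ := hx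
    have := orbit_mem_orbitSpan (ρ := ρ) w m (g * h)
    rwa [map_mul, map_mul] at this
  | zero => simp [← Prod.zero_eq_mk]
  | add x y _ _ hx hy => simpa using add_mem hx hy
  | smul c x _ hx => simpa using Submodule.smul_mem _ c hx

open Filter Topology in
/-- The leading coefficient of the contraction recovers the coordinate at `e_m`. -/
theorem tendsto_contraction (hρ : IsAlgebraicRep ρ) {m j : Fin n} (hm : ∀ i, i ≤ m)
    (hj : j ≠ m) {w : V} (hw : IsHighestWeightVector ρ (Pi.single m 1) w) (ψ : Module.Dual ℂ V)
    {x : V × (Idx n → ℂ)} (hx : x ∈ orbitSpan ρ w m) :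
    Tendsto (fun s : ℂˣ => ψ ((s : ℂ) • ρ (torus (cochar (Sum.inl m) s))⁻¹ x.1))
      (comap Units.val (𝓝 0)) (𝓝 (x.2 (Sum.inl m) * ψ w)) := by
  -- The limit statement is linear in the pair `x`, so it defines a subspace and only has to be
  -- checked on orbit points with nonzero coordinate at `e_m`.
  let N : Submodule ℂ (V × (Idx n → ℂ)) :=
    { carrier := {x | Tendsto
        (fun s : ℂˣ => ψ ((s : ℂ) • ρ (torus (cochar (Sum.inl m) s))⁻¹ x.1))
        (comap Units.val (𝓝 0)) (𝓝 (x.2 (Sum.inl m) * ψ w))}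
      zero_mem' := by simp [tendsto_const_nhds]
      add_mem' := by
        intro x y hx hy
        simpa [add_mul, mul_add] using Tendsto.add hx hy
      smul_mem' := by
        intro c x hx
        simpa [mul_assoc, mul_left_comm] using Tendsto.const_mul c hx }
  suffices h : orbitSpan ρ w m ≤ N from h hx
  refine Submodule.span_le.2 ?_
  rintro _ ⟨g, rfl⟩
  refine orbit_mem_of_coord_ne_zero hρ hj w N (fun g hg => ?_) g
  obtain ⟨γ, hγ, hγ0, hγs⟩ := exists_contracting_curve hρ hm hw g hg rfl
  obtain ⟨q, hq⟩ := hρ.exists_polynomial hγ w ψ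
  have hq0 : q.eval 0 = ψ w := by rw [← hq, hγ0, map_one, Module.End.one_apply]
  change Tendsto (fun s : ℂˣ => ψ ((s : ℂ) • ρ (torus (cochar (Sum.inl m) s))⁻¹ (ρ g w))) _ _
  simp only [hγs, map_smul, hq, smul_eq_mul]
  rw [← hq0]
  exact ((q.continuous.tendsto 0).comp tendsto_comap).const_mul _

/-- With zero `V`-component the contraction limit is zero, so the coordinate of `y` at `e_m`
vanishes, and likewise for every translate of `y`. By transitivity every coordinate of `y` is the
coordinate at `e_m` of some translate. -/
theorem eq_zero_of_zero_mem_orbitSpan (hρ : IsAlgebraicRep ρ) {m j : Fin n} (hm : ∀ i, i ≤ m)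
    (hj : j ≠ m) {w : V} (hw : IsHighestWeightVector ρ (Pi.single m 1) w) {y : Idx n → ℂ}
    (hy : ((0 : V), y) ∈ orbitSpan ρ w m) : y = 0 := by
  obtain ⟨ψ, hψ⟩ : ∃ ψ : Module.Dual ℂ V, ψ w ≠ 0 := by
    by_contra! h
    exact hw.1 ((Module.forall_dual_apply_eq_zero_iff ℂ w).1 h)
  have : (Filter.comap (Units.val : ℂˣ → ℂ) (nhds 0)).NeBot := by
    refine Filter.comap_neBot fun t ht => ?_
    obtain ⟨z, hz, hzt⟩ := (dense_compl_singleton (0 : ℂ)).inter_nhds_nonempty ht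
    exact ⟨Units.mk0 z hz, hzt⟩
  have hcoord : ∀ g : SO n, std n g y (Sum.inl m) = 0 := by
    intro g
    have h1 := tendsto_contraction hρ hm hj hw ψ (orbitSpan_invariant g hy)
    simp only [map_zero, smul_zero] at h1
    have h2 := tendsto_nhds_unique h1 tendsto_const_nhds
    exact (mul_eq_zero.1 h2).resolve_right hψ
  ext c
  obtain ⟨h, hh⟩ := exists_std_single_eq_univ (c := (Sum.inr m : Idx n)) (j := j) hj
    (bil_single_self c.swap) (by simp)
  have := bil_std h⁻¹ y (Pi.single c.swap 1)
  rw [std_eq_of_inv hh, bil_single_right, bil_single_right] at this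
  simpa [hcoord] using this.symm

theorem eq_bot_or_eq_top_of_invariant [ρ.IsIrreducible] (N : Submodule ℂ V)
    (hN : ∀ g, ∀ v ∈ N, ρ g v ∈ N) : N = ⊥ ∨ N = ⊤ := by
  let N' : Subrepresentation ρ := ⟨N, fun g v hv => hN g v hv⟩
  exact (eq_bot_or_eq_top N').imp (congrArg Subrepresentation.toSubmodule)
    (congrArg Subrepresentation.toSubmodule)

/-- An irreducible representation with highest weight `l_n` is isomorphic to the standard
representation. -/
theorem exists_equiv_std [ρ.IsIrreducible] (hρ : IsAlgebraicRep ρ) {m j : Fin n}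
    (hm : ∀ i, i ≤ m) (hj : j ≠ m) {w : V}
    (hw : IsHighestWeightVector ρ (Pi.single m 1) w) :
    ∃ L : V ≃ₗ[ℂ] (Idx n → ℂ), L w = Pi.single (Sum.inl m) 1 ∧
      ∀ g v, L (ρ g v) = std n g (L v) := by
  set Γ := orbitSpan ρ w m with hΓ
  have hwΓ : (w, (Pi.single (Sum.inl m) 1 : Idx n → ℂ)) ∈ Γ := by
    simpa using orbit_mem_orbitSpan (ρ := ρ) w m 1
  let f₁ : Γ →ₗ[ℂ] V := LinearMap.fst ℂ _ _ ∘ₗ Γ.subtype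
  let f₂ : Γ →ₗ[ℂ] (Idx n → ℂ) := LinearMap.snd ℂ _ _ ∘ₗ Γ.subtype
  have inj₁ : Function.Injective f₁ := by
    rw [injective_iff_map_eq_zero]
    rintro ⟨⟨x, y⟩, hxy⟩ (rfl : x = 0)
    have := eq_zero_of_zero_mem_orbitSpan hρ hm hj hw hxy
    subst this
    rfl
  have surj₁ : Function.Surjective f₁ := by
    rw [← LinearMap.range_eq_top]
    refine (eq_bot_or_eq_top_of_invariant (ρ := ρ) _ ?_).resolve_left fun h => hw.1 ?_
    · rintro g _ ⟨x, rfl⟩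
      exact ⟨⟨_, orbitSpan_invariant g x.2⟩, rfl⟩
    · have : w ∈ LinearMap.range f₁ := ⟨⟨_, hwΓ⟩, rfl⟩
      rwa [h, Submodule.mem_bot] at this
  have inj₂ : Function.Injective f₂ := by
    -- The kernel of the second projection is an invariant subspace of `V`. Were it everything, `(w,
    -- 0)` and hence `(0, e_m)` would lie in `Γ`.
    have hker : Γ.comap (LinearMap.inl ℂ V (Idx n → ℂ)) = ⊥ := by
      refine (eq_bot_or_eq_top_of_invariant (ρ := ρ) _ ?_).resolve_right fun h => ?_
      · intro g v hv
        have := orbitSpan_invariant g hv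
        simpa using this
      · have h1 : (w, (0 : Idx n → ℂ)) ∈ Γ := by
          have : w ∈ Γ.comap (LinearMap.inl ℂ V (Idx n → ℂ)) := by rw [h]; trivial
          exact this
        have h2 := sub_mem hwΓ h1
        simp only [Prod.mk_sub_mk, sub_self, sub_zero] at h2
        have := congrFun (eq_zero_of_zero_mem_orbitSpan hρ hm hj hw h2) (Sum.inl m)
        simp at this
    rw [injective_iff_map_eq_zero]
    rintro ⟨⟨x, y⟩, hxy⟩ (rfl : y = 0)
    have : x ∈ Γ.comap (LinearMap.inl ℂ V (Idx n → ℂ)) := hxy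
    rw [hker, Submodule.mem_bot] at this
    subst this
    rfl
  have surj₂ : Function.Surjective f₂ := by
    rw [← LinearMap.range_eq_top, eq_top_iff, ← (Pi.basisFun ℂ (Idx n)).span_eq,
      Submodule.span_le]
    rintro _ ⟨c, rfl⟩
    obtain ⟨h, hh⟩ := exists_std_single_eq_univ (c := (Sum.inl m : Idx n)) (j := j) hj
      (bil_single_self c) (by simp)
    exact ⟨⟨_, orbit_mem_orbitSpan w m h⟩, by rw [Pi.basisFun_apply]; exact hh⟩
  let E₁ := LinearEquiv.ofBijective f₁ ⟨inj₁, surj₁⟩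
  let E₂ := LinearEquiv.ofBijective f₂ ⟨inj₂, surj₂⟩
  have hL : ∀ x : Γ, (E₁.symm.trans E₂) x.1.1 = x.1.2 := by
    intro x
    have : E₁.symm x.1.1 = x := E₁.symm_apply_apply x
    rw [LinearEquiv.trans_apply, this]
    rfl
  refine ⟨E₁.symm.trans E₂, hL ⟨_, hwΓ⟩, fun g v => ?_⟩
  obtain ⟨x, rfl⟩ := surj₁ v
  have e := hL x
  change (E₁.symm.trans E₂) (f₁ x) = _ at e
  rw [e]
  exact hL ⟨_, orbitSpan_invariant g x.2⟩

/-! ### Irreducibility of the quadric and the main theorem. -/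

theorem irreducible_sum_X_mul_X {n : ℕ} (hn : 2 ≤ n) :
    Irreducible (∑ i : Fin n, (X (Sum.inl i) * X (Sum.inr i) :
      MvPolynomial (Fin n ⊕ Fin n) ℂ)) := by
  have h := irreducible_sumSMulXSMulY (R := ℂ) (Finsupp.equivFunOnFinite.symm fun _ : Fin n => 1)
    (by
      refine ⟨⟨0, by omega⟩, by simp, ⟨1, by omega⟩, by simp, by simp⟩)
    (fun r hr => isUnit_of_dvd_one (by simpa using hr ⟨0, by omega⟩))
  convert h using 1
  rw [sumSMulXSMulY, Finsupp.linearCombination_apply, Finsupp.sum_fintype _ _ (by simp)]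
  simp

theorem eval_sum_X_mul_X {n : ℕ} (v : Idx n → ℂ) :
    eval v (∑ i : Fin n, (X (Sum.inl i) * X (Sum.inr i) : MvPolynomial (Fin n ⊕ Fin n) ℂ)) =
      ∑ i, v (Sum.inl i) * v (Sum.inr i) := by
  simp

end TypeD

theorem lemma3p6 (n : ℕ) (hn : 3 ≤ n) {V : Type*} [AddCommGroup V] [Module ℂ V]
    [FiniteDimensional ℂ V] (ρ : Representation ℂ (TypeD.SO n) V) [ρ.IsIrreducible]
    (hρ : TypeD.IsAlgebraicRep ρ) (lam : TypeD.Weight n)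
    (hlam : lam = Pi.single (⟨n - 1, by omega⟩ : Fin n) 1) (w : V)
    (hw : TypeD.IsHighestWeightVector ρ lam w) :
    ∃ (b : Module.Basis (Fin n ⊕ Fin n) ℂ V)
      (emb : TypeD.SO n ⧸ TypeD.parabolic lam → ℙ ℂ V),
      (∀ i : Fin n, TypeD.HasWeight ρ (Pi.single i 1) (b (Sum.inl i))) ∧
      (∀ i : Fin n, TypeD.HasWeight ρ (-Pi.single i 1) (b (Sum.inr i))) ∧
      (∀ g : TypeD.SO n,
        (emb (QuotientGroup.mk g)).submodule = Submodule.span ℂ {ρ g w}) ∧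
      Function.Injective emb ∧
      TypeD.IsDefinedBy b (Set.range emb)
        (∑ i : Fin n, (X (Sum.inl i) * X (Sum.inr i) : MvPolynomial (Fin n ⊕ Fin n) ℂ)) := by
  subst hlam
  set m : Fin n := ⟨n - 1, by omega⟩ with hm
  have hmax : ∀ i, i ≤ m := fun i => by rw [Fin.le_def]; simp only [hm]; omega
  set j : Fin n := ⟨0, by omega⟩ with hj
  have hjm : j ≠ m := by rw [Ne, Fin.ext_iff]; simp only [hm, hj]; omega
  obtain ⟨L, hLw, hL⟩ := TypeD.exists_equiv_std hρ hmax hjm hw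
  have hLsymm : ∀ g v, ρ g (L.symm v) = L.symm (TypeD.std n g v) := fun g v => by
    rw [LinearEquiv.eq_symm_apply, hL, LinearEquiv.apply_symm_apply]
  -- The basis is transported from `ℂ^{2n}`, so that coordinates on `V` are the standard coordinates
  -- of `L v`.
  set b := Module.Basis.ofEquivFun L with hb
  have hbc : ∀ c, b c = L.symm (Pi.single c 1) := fun c => Module.Basis.coe_ofEquivFun L ▸ rfl
  have hrepr : ∀ v, (b.repr v : TypeD.Idx n → ℂ) = L v := fun v => by
    ext c; simp [hb]
  have hne : ∀ g, ρ g w ≠ 0 := fun g h => hw.1 (by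
    rw [← ρ.inv_self_apply g w, h, map_zero])
  let emb : TypeD.SO n ⧸ TypeD.parabolic (Pi.single m 1) → ℙ ℂ V :=
    Quotient.lift (fun g => Projectivization.mk ℂ (ρ g w) (hne g)) (by
      intro g h hgh
      obtain ⟨x, hx, -, e⟩ :=
        TypeD.parabolic_acts_on_lines hρ hmax hw (QuotientGroup.leftRel_apply.1 hgh)
      refine ((Projectivization.mk_eq_mk_iff' ℂ _ _ _ _).2 ⟨x, ?_⟩).symm
      rw [← map_smul, ← e, ← Module.End.mul_apply, ← map_mul, mul_inv_cancel_left])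
  have hmk : ∀ g : TypeD.SO n, emb (QuotientGroup.mk g) = Projectivization.mk ℂ (ρ g w) (hne g) :=
    fun _ => rfl
  have hrange : Set.range emb = {p | ∀ v ∈ p.submodule, eval (b.repr v)
      (∑ i : Fin n, (X (Sum.inl i) * X (Sum.inr i) : MvPolynomial (Fin n ⊕ Fin n) ℂ)) = 0} := by
    ext p
    simp only [Set.mem_range, Set.mem_ofPred_eq, hrepr, TypeD.eval_sum_X_mul_X]
    constructor
    · rintro ⟨q, rfl⟩ v hv
      obtain ⟨g, rfl⟩ := QuotientGroup.mk_surjective q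
      rw [hmk, Projectivization.submodule_mk, Submodule.mem_span_singleton] at hv
      obtain ⟨x, rfl⟩ := hv
      have := TypeD.bil_self (L (x • ρ g w))
      rw [map_smul, TypeD.bil_smul_left, TypeD.bil_smul_right, hL, TypeD.bil_std, hLw,
        TypeD.bil_single_self, mul_zero, mul_zero, ← hLw, ← hL, ← map_smul] at this
      simpa using this
    · induction p using Projectivization.ind with
      | h v hv =>
      intro h
      have h0 := h v (by
        rw [Projectivization.submodule_mk]; exact Submodule.mem_span_singleton_self v)
      obtain ⟨g, hg⟩ := TypeD.exists_std_single_eq_univ (c := (Sum.inl m : TypeD.Idx n)) (j := j)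
        hjm (v := L v) (by rw [TypeD.bil_self, h0, mul_zero]) (by simpa using hv)
      rw [← hLw, ← hL] at hg
      refine ⟨QuotientGroup.mk g, ?_⟩
      rw [hmk]
      congr 1
      exact L.injective hg
  refine ⟨b, emb, fun i => ?_, fun i => ?_, fun g => rfl, ?_, hrange, ?_⟩
  · rw [TypeD.hasWeight_single]
    intro t
    rw [hbc, hLsymm, TypeD.std_torus_single, map_smul]
    rfl
  · rw [TypeD.hasWeight_neg_single]
    intro t
    rw [hbc, hLsymm, TypeD.std_torus_single, map_smul]
    rfl
  · intro q r hqr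
    obtain ⟨g, rfl⟩ := QuotientGroup.mk_surjective q
    obtain ⟨h, rfl⟩ := QuotientGroup.mk_surjective r
    rw [hmk, hmk, Projectivization.mk_eq_mk_iff'] at hqr
    obtain ⟨x, hx⟩ := hqr
    rw [eq_comm, QuotientGroup.eq]
    refine TypeD.mem_parabolic_of_std_eq_smul (x := x) ?_
    rw [← hLw, ← hL, map_mul, Module.End.mul_apply, ← hx, map_smul, ρ.inv_self_apply, map_smul]
  · have hcone : TypeD.coneInCoordinates b (Set.range emb) = zeroLocus ℂ (Ideal.span
        {∑ i : Fin n, (X (Sum.inl i) * X (Sum.inr i) : MvPolynomial (Fin n ⊕ Fin n) ℂ)}) := by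
      rw [zeroLocus_span]
      ext x
      simp only [Set.mem_singleton_iff, forall_eq, Set.mem_ofPred_eq, aeval_eq_eval]
      constructor
      · rintro ⟨p, hp, v, hv, rfl⟩
        rw [hrange] at hp
        exact hp v hv
      · intro hx
        -- The origin lies on every line, so the cone contains it as soon as the orbit is nonempty;
        -- the base point serves.
        by_cases hx0 : x = 0
        · exact ⟨emb (QuotientGroup.mk 1), ⟨_, rfl⟩, 0, zero_mem _, by simp [hx0]⟩
        · refine ⟨Projectivization.mk ℂ (L.symm x) (by simpa using hx0), ?_, L.symm x,
            Submodule.mem_span_singleton_self _, by rw [hrepr, LinearEquiv.apply_symm_apply]⟩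
          rw [hrange]
          intro v hv
          obtain ⟨y, rfl⟩ := Submodule.mem_span_singleton.1 hv
          rw [TypeD.eval_sum_X_mul_X] at hx
          rw [hrepr, map_smul, LinearEquiv.apply_symm_apply, TypeD.eval_sum_X_mul_X]
          have := TypeD.bil_self (y • x)
          rw [TypeD.bil_smul_left, TypeD.bil_smul_right, TypeD.bil_self, hx] at this
          simpa using this
    have hirr := TypeD.irreducible_sum_X_mul_X (n := n) (by omega)
    have hprime := (Ideal.span_singleton_prime hirr.ne_zero).2 hirr.prime
    -- Nullstellensatz: a prime ideal over `ℂ` is the full vanishing ideal of its zero locus.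
    rw [hcone, IsPrime.vanishingIdeal_zeroLocus]
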